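/- **Setting.** An instance consists of a finite undirected (multi)graph $G=(V,E)$ with a root $r\in V$, edge costs $c(e)>0$ and vertex prizes $p(v)\ge 0$, such that every vertex $v$ with $p(v)>0$ can be reached from $r$. For a subgraph $H$ let $p(H)$ and $c(H)$ be the total prize of its vertices and the total cost of its edges. A *rooted subtree* is a subtree of $G$ that contains $r$; $\mathrm{Opt}(B)$ is a rooted subtree of maximum prize among those of cost at most $B$. An *incremental solution* is an ordering $\pi$ of a subset of the edges such that every prefix of $\pi$ induces a rooted subtree (the empty prefix induces $(\{r\},\emptyset)$) and the whole sequence spans all vertices of positive prize; $\mathrm{Alg}(B)$ is the rooted subtree induced by the longest prefix of $\pi$ of cost at most $B$. For $\alpha\ge 0$ (which may depend on the instance) and $\mu\ge 1$, an algorithm is *$(\alpha,\mu)$-competitive* if on every instance it produces an incremental solution with $\mu\,p(\mathrm{Alg}(B+\alpha))\ge p(\mathrm{Opt}(B))$ for all $B\ge 0$. Let $\gamma$ be the maximum cost of a path (without repeated vertices) in $G$ that starts in $r$, and let $\chi=\max_{v\in V}\ell(v)$ be the eccentricity of $r$, where $\ell(v)$ is the minimum cost of an $r$-$v$-path. **Density-greedy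 algorithm.** The density of a rooted subtree $T$ is $d(T)=p(T)/c(T)$, and $d((\{r\},\emptyset))=0$. A *min-max subtree* is an inclusion-wise minimal element of the set of rooted subtrees of maximum density. For a rooted subtree $\bar T$, the contracted graph $G/\bar T$ arises by contracting $\bar T$ into the root, keeping all other edges (also parallel edges and loops) with their costs, and keeping the prizes except that the root gets prize $0$. *On trees:* start with $\pi=()$ and $\bar T=(\{r\},\emptyset)$; while $G/\bar T$ has non-zero total prize, fix an arbitrary min-max subtree of $G/\bar T$, append the edge of $G$ that corresponds to its unique edge incident to $r$ to $\pi$, and add this edge to $\bar T$. *On general graphs:* start with $\pi=()$ and $\bar T=(\{r\},\emptyset)$; while $G/\bar T$ has non-zero total prize, fix an arbitrary min-max subtree $T^*$ of $G/\bar T$, let $T^+$ be the subgraph of $G$ induced by the edges that correspond to those of $T^*$, run the algorithm for trees on $T^+/\bar T$ (as a subgraph of the network $G/\bar T$), append the returned sequence to $\pi$, and add the edges of $T^+$ to $\bar T$. **Theorem.** The density-greedy algorithm for general graphs can be carried out to its end on every instance. Moreover, whatever min-max subtrees are fixed in its steps, it is $(\gamma,2)$-competitive, but for no $\mu\ge 1$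 is it $(\chi,\mu)$-competitive, not even when only the instances are considered whose graph is connected and simple and whose root has prize $0$. -/

import Mathlib

open scoped Graph

noncomputable section

namespace PCST

open Classical in
/-- The map that identifies all vertices of `X` with the vertex `r`. -/
def collapse {V : Type} (X : Set V) (r : V) (v : V) : V := if v ∈ X then r else v

section GraphNotions

variable {V E : Type}

/-- `IsWalk G u w v`: starting in `u`, the list `w` of pairs (edge, next vertex) is a walk of the
multigraph `G` that ends in `v`. -/
inductive IsWalk (G : Graph V E) : V → List (E × V) → V → Prop
  | nil {u : V} : u ∈ V(G) → IsWalk G u [] u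
  | cons {u v x : V} {e : E} {w : List (E × V)} :
      G.IsLink e u v → IsWalk G v w x → IsWalk G u ((e, v) :: w) x

/-- A path is a walk without repeated vertices. -/
def IsPath (G : Graph V E) (u : V) (w : List (E × V)) (v : V) : Prop :=
  IsWalk G u w v ∧ (u :: w.map Prod.snd).Nodup

/-- A cycle is a nonempty closed walk without repeated edges in which, apart from the fact that the
last vertex equals the first one, no vertex is repeated (a loop is a cycle of length one, two
parallel edges form a cycle of length two). -/
def IsCycle (G : Graph V E) (u : V) (w : List (E × V)) : Prop :=
  w ≠ [] ∧ IsWalk G u w u ∧ (w.map Prod.fst).Nodup ∧ (w.map Prod.snd).Nodup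

/-- There is a walk from `u` to `v`. -/
def Reachable (G : Graph V E) (u v : V) : Prop := ∃ w, IsWalk G u w v

/-- A connected (nonempty) multigraph. -/
def IsConnected (G : Graph V E) : Prop :=
  V(G).Nonempty ∧ ∀ u ∈ V(G), ∀ v ∈ V(G), Reachable G u v

/-- A tree is a connected multigraph without cycles. -/
def IsTree (G : Graph V E) : Prop := IsConnected G ∧ ∀ u w, ¬ IsCycle G u w

/-- The subgraph of `G` with edge set `E(G) ∩ F` whose vertices are those of `X` and the ends of the
edges in `F`. -/
def spanned (G : Graph V E) (X : Set V) (F : Set E) : Graph V E where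
  vertexSet := X ∪ {v | ∃ e ∈ F, G.Inc e v}
  edgeSet := E(G) ∩ F
  IsLink e x y := e ∈ F ∧ G.IsLink e x y
  isLink_symm _ _ := ⟨fun _ _ h => ⟨h.1, h.2.symm⟩⟩
  eq_or_eq_of_isLink_of_isLink _ _ _ _ _ h h' := h.2.left_eq_or_eq h'.2
  edge_mem_iff_exists_isLink e := by
    constructor
    · rintro ⟨he, hF⟩
      obtain ⟨x, y, h⟩ := Graph.exists_isLink_of_mem_edgeSet he
      exact ⟨x, y, hF, h⟩
    · rintro ⟨x, y, hF, h⟩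
      exact ⟨h.edge_mem, hF⟩
  left_mem_of_isLink _ _ y h := Or.inr ⟨_, h.1, y, h.2⟩

/-- The subgraph of `G` induced by an edge set `F`: the edges in `F` and their ends. -/
def edgeInduced (G : Graph V E) (F : Set E) : Graph V E := spanned G ∅ F

end GraphNotions

/-- A multigraph with a root vertex, edge costs and vertex prizes. -/
structure Network (V E : Type) where
  graph : Graph V E
  root : V
  cost : E → ℝ
  prize : V → ℝ

namespace Network

variable {V E : Type} (N : Network V E)

/-- `p(H)`, the total prize of the vertices of `H`. -/
def prizeOf (H : Graph V E) : ℝ := ∑ᶠ v ∈ V(H), N.prize v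

/-- `c(H)`, the total cost of the edges of `H`. -/
def costOf (H : Graph V E) : ℝ := ∑ᶠ e ∈ E(H), N.cost e

/-- The total cost of a list of edges. -/
def listCost (π : List E) : ℝ := (π.map N.cost).sum

/-- `𝒯`: the subtrees of the graph that contain the root. -/
def IsRootedSubtree (T : Graph V E) : Prop :=
  T ≤ N.graph ∧ IsTree T ∧ N.root ∈ V(T)

/-- The density `p(T) / c(T)`. For the tree without edges we have `c(T) = 0`, and the value is `0`
by the convention `x / 0 = 0`. -/
def density (T : Graph V E) : ℝ := N.prizeOf T / N.costOf T

/-- A rooted subtree of maximum density. -/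
def HasMaxDensity (T : Graph V E) : Prop :=
  N.IsRootedSubtree T ∧ ∀ T', N.IsRootedSubtree T' → N.density T' ≤ N.density T

/-- A min-max subtree: an inclusion-wise minimal rooted subtree of maximum density. -/
def IsMinMax (T : Graph V E) : Prop := Minimal N.HasMaxDensity T

/-- The rooted subgraph induced by a set of edges; it is `({root}, ∅)` for the empty set. -/
def rooted (F : Set E) : Graph V E := spanned N.graph {N.root} F

open Classical in
/-- The contracted graph `G / T`: all vertices of `T` are merged into the root, the edges of `T`
disappear, all other edges are kept (possibly as loops or parallel edges) with their names and
costs, prizes are kept, except that the root gets prize `0`. -/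
def contract (T : Graph V E) : Network V E where
  graph := (N.graph.deleteEdges E(T)).map (collapse V(T) N.root)
  root := N.root
  cost := N.cost
  prize v := if v = N.root then 0 else N.prize v

/-- The contracted subgraph `S / T`: the subgraph of `G / T` induced by the edges of `S` that are
not edges of `T`. -/
def contractSub (S T : Graph V E) : Graph V E :=
  edgeInduced (N.contract T).graph (E(S) \ E(T))

/-- The extension `C⁺` in `G` of a subgraph `C` of a contracted graph: the subgraph of `G` induced
by the edges that correspond to the edges of `C`. -/
def extension (C : Graph V E) : Graph V E := edgeInduced N.graph E(C)

/-- The total prize of the network. -/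
def totalPrize : ℝ := N.prizeOf N.graph

/-- The network `N` restricted to a subgraph `H` of its graph. -/
def restrictTo (H : Graph V E) : Network V E where
  graph := H
  root := N.root
  cost := N.cost
  prize := N.prize

/-- The states `π` that the density-greedy algorithm for trees can reach on `N`. The contracted tree
is always the rooted tree formed by the edges of `π`. While the contracted network has non-zero
total prize, an arbitrary min-max subtree `T` of it is fixed, and its unique edge at the root is
appended to `π`. -/
inductive TreeGreedyRun : List E → Prop
  | start : TreeGreedyRun []
  | step (π : List E) (T : Graph V E) (e : E) :
      TreeGreedyRun π →
      (N.contract (N.rooted {f | f ∈ π})).totalPrize ≠ 0 →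
      (N.contract (N.rooted {f | f ∈ π})).IsMinMax T →
      T.Inc e N.root →
      (∀ f, T.Inc f N.root → f = e) →
      TreeGreedyRun (π ++ [e])

/-- `π` is returned by a run of the density-greedy algorithm for trees on `N`. -/
def TreeGreedyOutput (π : List E) : Prop :=
  N.TreeGreedyRun π ∧ (N.contract (N.rooted {f | f ∈ π})).totalPrize = 0

/-- The states `(π, F)` that the density-greedy algorithm for general graphs can reach on `N`; here
`F` is the edge set of the rooted tree `T̄` that is contracted. While `G / T̄` has non-zero total
prize, an arbitrary min-max subtree `T` of `G / T̄` is fixed, with extension `T⁺` in `G`, the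
algorithm for trees is run on `T⁺ / T̄`, the solution `ρ` that it returns is appended to `π`, and the
edges of `T⁺` are added to `T̄`. -/
inductive GreedyRun : List E → Set E → Prop
  | start : GreedyRun [] ∅
  | step (π : List E) (F : Set E) (T : Graph V E) (ρ : List E) :
      GreedyRun π F →
      (N.contract (N.rooted F)).totalPrize ≠ 0 →
      (N.contract (N.rooted F)).IsMinMax T →
      ((N.contract (N.rooted F)).restrictTo
        (N.contractSub (N.extension T) (N.rooted F))).TreeGreedyOutput ρ →
      GreedyRun (π ++ ρ) (F ∪ E(N.extension T))

/-- `π` is returned by a run of the density-greedy algorithm for general graphs on `N`. -/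
def GreedyOutput (π : List E) : Prop :=
  ∃ F, N.GreedyRun π F ∧ (N.contract (N.rooted F)).totalPrize = 0

/-- An incremental solution: an ordering of a subset of the edges such that every prefix induces a
rooted subtree and the whole sequence spans all vertices with positive prize. -/
def IsIncrementalSolution (π : List E) : Prop :=
  π.Nodup ∧ (∀ e ∈ π, e ∈ E(N.graph)) ∧
  (∀ j ≤ π.length, N.IsRootedSubtree (N.rooted {e | e ∈ π.take j})) ∧
  ∀ v ∈ V(N.graph), 0 < N.prize v → v ∈ V(N.rooted {e | e ∈ π})

/-- `Alg(B)`: the rooted subtree induced by the edges `e_i` of `π` such that the first `i` edges of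
`π` have total cost at most `B`. -/
def algTree (π : List E) (B : ℝ) : Graph V E :=
  N.rooted {e | ∃ i, π[i]? = some e ∧ N.listCost (π.take (i + 1)) ≤ B}

/-- `T` is a possible choice for `Opt(B)`: a rooted subtree of cost at most `B` with maximum
prize. -/
def IsOpt (B : ℝ) (T : Graph V E) : Prop :=
  (N.IsRootedSubtree T ∧ N.costOf T ≤ B) ∧
  ∀ T', N.IsRootedSubtree T' → N.costOf T' ≤ B → N.prizeOf T' ≤ N.prizeOf T

/-- `γ`: the maximum cost of a path that starts in the root. -/
def gamma : ℝ :=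
  sSup {x | ∃ w v, IsPath N.graph N.root w v ∧ x = N.listCost (w.map Prod.fst)}

/-- `ℓ(v)`: the minimum cost of a path from the root to `v`. -/
def dist (v : V) : ℝ :=
  sInf {x | ∃ w, IsPath N.graph N.root w v ∧ x = N.listCost (w.map Prod.fst)}

/-- `χ`: the eccentricity of the root, i.e. the maximum of `ℓ(v)` over all vertices `v`. -/
def chi : ℝ := sSup (N.dist '' V(N.graph))

end Network

/-- An instance of the incremental prize-collecting Steiner-tree problem: a finite multigraph with a
root, positive edge costs and non-negative vertex prizes, in which every vertex with positive prize
can be reached from the root. -/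
structure Instance where
  V : Type
  E : Type
  finite_V : Finite V
  finite_E : Finite E
  net : Network V E
  root_mem : net.root ∈ V(net.graph)
  cost_pos : ∀ e ∈ E(net.graph), 0 < net.cost e
  prize_nonneg : ∀ v ∈ V(net.graph), 0 ≤ net.prize v
  reachable : ∀ v ∈ V(net.graph), 0 < net.prize v → Reachable net.graph net.root v

/-- An assignment of a sequence of edges to every instance. -/
def Algorithm : Type 1 := ∀ I : Instance, List I.E

/-- `A` implements the density-greedy algorithm for general graphs, with some way of making the
arbitrary choices of min-max subtrees. -/
def IsDensityGreedy (A : Algorithm) : Prop := ∀ I : Instance, I.net.GreedyOutput (A I)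

/-- `A` is `(α, μ)`-competitive on the instances in `C`: it produces incremental solutions and
`μ · p(Alg(B + α)) ≥ p(Opt(B))` for every budget `B ≥ 0`. The slack `α` may depend on the
instance. -/
def IsCompetitiveOn (C : Set Instance) (A : Algorithm) (α : Instance → ℝ) (μ : ℝ) : Prop :=
  ∀ I ∈ C, I.net.IsIncrementalSolution (A I) ∧
    ∀ B : ℝ, 0 ≤ B → ∀ T, I.net.IsOpt B T →
      I.net.prizeOf T ≤ μ * I.net.prizeOf (I.net.algTree (A I) (B + α I))

/-- Instances whose graph is connected and simple and whose root has prize `0`. -/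
def ConnectedSimple : Set Instance :=
  {I : Instance | IsConnected I.net.graph ∧ Graph.Simple I.net.graph ∧ I.net.prize I.net.root = 0}

end PCST

end

set_option linter.unusedSectionVars false

open scoped Graph

noncomputable section

namespace PCST

/-! ### Rooted subtrees as edge sets grown by pendant edges -/

namespace Network

variable {V E : Type} {N : Network V E} {F O X Y Z S : Set E} {e f : E} {x y v : V}

/-! Everything is phrased in terms of `Feasible` edge sets, which are exactly the edge sets of
rooted subtrees (`Feasible.isRootedSubtree`, `IsRootedSubtree.feasible`). The feasible subsets of a
fixed feasible set are closed under union and intersection, and on them prize and cost are modular.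
By `feasible_contract_iff` and `setPrize_contract`, contracting a feasible `X` just means passing to
marginal prize and cost over `X`. A min-max subtree of the contracted network thus becomes a set `S`
of largest marginal density `lam` over `X`, every proper nonempty part of which has smaller marginal
density (`RelMinMax`).

Upper bound, inside one min-max tree `Z` of density `d`. Let the run for trees pass through states
`X i`, fixing `S i` and appending its root edge `e i`. By modularity, as long as `X i ∪ S i` is not
exhausted, later min-max sets stay inside it (`RelMinMax.subset_of_ssubset`). Fix `k` and look at a
state `a < k`. If `e k ∉ S a`, the run must complete `X a ∪ S a` by time `k`, so this stretch is
paid at density at least `d`. If `e k ∈ S a`, the edge `e a` is left unpaid; but it is the only edge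
of `S a` at the contracted root, so every rooted subtree of `Z` containing `e k` contains it. All
unpaid edges therefore lie on the path to `e k` and cost at most γ together. This gives `d *
(c(prefix with e k) - γ) ≤ p(prefix)` (`TreeGreedyRun.prize_take`).

For general graphs, the densities of successive phases do not increase, so the same estimate holds
for the whole sequence with `d` the density of the current phase (`GreedyInvariant`). Take the first
edge that exceeds the budget `B + γ`. A tree `O` of cost at most `B` has prize at most `p(prefix) +
d * B`, and `d * B ≤ p(prefix)`; hence the factor 2. Runs terminate because every step appends new
edges.

Lower bound. In the instance `Detour.inst` every vertex is within distance 91 of the root, but the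
unique min-max subtree avoids nearly all direct root edges. The run within it starts with a path of
costs 90, 51, 42 and earns its first prize with the third edge, at total cost 183 > 91 + 91. With
budget 91 a direct edge already earns 87, so no factor `μ` helps. -/

theorem mem_rooted : v ∈ V(N.rooted F) ↔ v = N.root ∨ ∃ e ∈ F, N.graph.Inc e v := Iff.rfl

theorem root_mem_rooted : N.root ∈ V(N.rooted F) := Or.inl rfl

theorem mem_rooted_of_inc (he : e ∈ F) (h : N.graph.Inc e v) : v ∈ V(N.rooted F) :=
  Or.inr ⟨e, he, h⟩

theorem rooted_union_verts : V(N.rooted (X ∪ Y)) = V(N.rooted X) ∪ V(N.rooted Y) := by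
  ext v
  simp only [Set.mem_union, mem_rooted]
  constructor
  · rintro (h | ⟨e, h | h, h'⟩)
    · exact Or.inl (Or.inl h)
    · exact Or.inl (Or.inr ⟨e, h, h'⟩)
    · exact Or.inr (Or.inr ⟨e, h, h'⟩)
  · rintro ((h | ⟨e, h, h'⟩) | (h | ⟨e, h, h'⟩))
    · exact Or.inl h
    · exact Or.inr ⟨e, Or.inl h, h'⟩
    · exact Or.inl h
    · exact Or.inr ⟨e, Or.inr h, h'⟩

theorem rooted_verts_mono (h : X ⊆ Y) : V(N.rooted X) ⊆ V(N.rooted Y) := by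
  rw [← Set.union_eq_self_of_subset_left h, rooted_union_verts]
  exact Set.subset_union_left

theorem rooted_empty_verts : V(N.rooted (∅ : Set E)) = {N.root} := by
  ext v
  simp [mem_rooted]

theorem rooted_insert_verts (h : N.graph.IsLink e x y) (hx : x ∈ V(N.rooted F)) :
    V(N.rooted (insert e F)) = insert y V(N.rooted F) := by
  ext v
  constructor
  · rintro (rfl | ⟨f, rfl | hf, h'⟩)
    · exact Or.inr root_mem_rooted
    · obtain rfl | rfl := h'.eq_or_eq_of_isLink h
      · exact Or.inr hx
      · exact Or.inl rfl
    · exact Or.inr (mem_rooted_of_inc hf h')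
  · rintro (rfl | hv)
    · exact mem_rooted_of_inc (Set.mem_insert _ _) h.inc_right
    · exact rooted_verts_mono (Set.subset_insert _ _) hv

/-- The edge sets of the rooted subtrees that arise by repeatedly adding pendant edges. -/
inductive Feasible (N : Network V E) : Set E → Prop
  | empty : Feasible N ∅
  | insert {F : Set E} {e : E} {x y : V} : Feasible N F → N.graph.IsLink e x y →
      x ∈ V(N.rooted F) → y ∉ V(N.rooted F) → Feasible N (insert e F)

theorem notMem_of_link_notMem (h : N.graph.IsLink e x y) (hy : y ∉ V(N.rooted F)) : e ∉ F :=
  fun he => hy (mem_rooted_of_inc he h.inc_right)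

namespace Feasible

theorem subset (h : N.Feasible F) : F ⊆ E(N.graph) := by
  induction h with
  | empty => exact Set.empty_subset _
  | insert _ hl _ _ ih => exact Set.insert_subset hl.edge_mem ih

/-- An edge of a feasible set leaves every vertex set that contains the root but does not contain
all vertices. -/
theorem exists_link_leaving (h : N.Feasible F) {W : Set V} (hr : N.root ∈ W)
    (hv : v ∈ V(N.rooted F)) (hvW : v ∉ W) :
    ∃ e ∈ F, ∃ x ∈ W, ∃ y ∉ W, N.graph.IsLink e x y := by
  induction h generalizing v with
  | empty =>
    rw [rooted_empty_verts] at hv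
    obtain rfl := hv
    exact absurd hr hvW
  | @insert F e x y hF hl hx hy ih =>
    rw [rooted_insert_verts hl hx] at hv
    by_cases hxW : x ∈ W
    · by_cases hyW : y ∈ W
      · obtain rfl | hv := hv
        · exact absurd hyW hvW
        · obtain ⟨f, hf, h⟩ := ih hv hvW
          exact ⟨f, Or.inr hf, h⟩
      · exact ⟨e, Or.inl rfl, x, hxW, y, hyW, hl⟩
    · obtain ⟨f, hf, h⟩ := ih hx hxW
      exact ⟨f, Or.inr hf, h⟩

/-- Each insertion adds one edge and one new vertex. This count stands in for acyclicity below. -/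
theorem ncard_verts [Finite V] [Finite E] (h : N.Feasible F) :
    V(N.rooted F).ncard = F.ncard + 1 := by
  induction h with
  | empty => simp [rooted_empty_verts]
  | insert _ hl hx hy ih =>
    rw [rooted_insert_verts hl hx, Set.ncard_insert_of_notMem hy (Set.toFinite _), ih,
      Set.ncard_insert_of_notMem (notMem_of_link_notMem hl hy) (Set.toFinite _)]

/-- A feasible set can be extended by edges of another one until it covers its vertices. -/
theorem exists_extension (hF : N.Feasible F) (hO : N.Feasible O) :
    ∃ S ⊆ O, N.Feasible (F ∪ S) ∧ V(N.rooted O) ⊆ V(N.rooted (F ∪ S)) := by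
  induction hO with
  | empty =>
    refine ⟨∅, subset_rfl, by simpa using hF, ?_⟩
    exact rooted_verts_mono (Set.empty_subset _)
  | @insert O e x y hO hl hx hy ih =>
    obtain ⟨S, hS, hFS, hv⟩ := ih
    rw [rooted_insert_verts hl hx]
    by_cases hy' : y ∈ V(N.rooted (F ∪ S))
    · exact ⟨S, hS.trans (Set.subset_insert _ _), hFS, Set.insert_subset hy' hv⟩
    · refine ⟨Insert.insert e S, Set.insert_subset_insert hS, ?_, ?_⟩
      · rw [Set.union_insert]
        exact hFS.insert hl (hv hx) hy'
      · rw [Set.union_insert, rooted_insert_verts hl (hv hx)]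
        exact Set.insert_subset_insert hv

/-! ### The lattice of feasible subsets of a feasible set -/

variable [Finite V] [Finite E]

/-- A proper feasible superset has more edges, hence by `ncard_verts` more vertices, so one of its
edges leaves the vertices of `X`. -/
theorem exists_insert (hX : N.Feasible X) (hY : N.Feasible Y) (h : X ⊂ Y) :
    ∃ e ∈ Y, e ∉ X ∧ ∃ x ∈ V(N.rooted X), ∃ y ∉ V(N.rooted X), N.graph.IsLink e x y := by
  by_cases hv : V(N.rooted Y) ⊆ V(N.rooted X)
  · have h1 := Set.ncard_le_ncard hv (Set.toFinite _)
    rw [hX.ncard_verts, hY.ncard_verts] at h1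
    have h2 := Set.ncard_lt_ncard h (Set.toFinite _)
    omega
  · obtain ⟨v, hv, hvX⟩ := Set.not_subset.1 hv
    obtain ⟨e, he, x, hx, y, hy, hl⟩ := hY.exists_link_leaving root_mem_rooted hv hvX
    exact ⟨e, he, notMem_of_link_notMem hl hy, x, hx, y, hy, hl⟩

/-- Induction along a construction of a feasible set from a feasible subset. -/
theorem induction_from {motive : Set E → Prop} (hX : N.Feasible X) (hY : N.Feasible Y)
    (h : X ⊆ Y) (base : motive X)
    (step : ∀ (W : Set E) (e : E) (x y : V), N.Feasible W → X ⊆ W → W ⊆ Y → e ∈ Y →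
      N.graph.IsLink e x y → x ∈ V(N.rooted W) → y ∉ V(N.rooted W) → motive W →
      motive (Insert.insert e W)) : motive Y := by
  -- Induction on the number of edges of `Y` still missing; `exists_insert` supplies the next
  -- pendant edge.
  suffices H : ∀ n, ∀ W : Set E, N.Feasible W → X ⊆ W → W ⊆ Y → (Y \ W).ncard = n →
      motive W → motive Y from H _ X hX subset_rfl h rfl base
  intro n
  induction n with
  | zero =>
    intro W hW hXW hWY hn hm
    rw [Set.ncard_eq_zero (Set.toFinite _), Set.sdiff_eq_empty] at hn
    rwa [subset_antisymm hn hWY]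
  | succ n ih =>
    intro W hW hXW hWY hn hm
    have hss : W ⊂ Y := by
      refine hWY.ssubset_of_ne ?_
      rintro rfl
      simp at hn
    obtain ⟨e, he, heW, x, hx, y, hy, hl⟩ := hW.exists_insert hY hss
    refine ih (Insert.insert e W) (hW.insert hl hx hy) (hXW.trans (Set.subset_insert _ _))
      (Set.insert_subset he hWY) ?_ (step W e x y hW hXW hWY he hl hx hy hm)
    have : Y \ Insert.insert e W = (Y \ W) \ {e} := by
      ext f
      simp only [Set.mem_sdiff, Set.mem_insert_iff, Set.mem_singleton_iff]
      tauto
    rw [this, Set.ncard_sdiff_singleton_of_mem (show e ∈ Y \ W from ⟨he, heW⟩), hn]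
    rfl

/-- Within a feasible set, a feasible subset contains all edges both ends of which it covers. -/
theorem mem_of_ends_mem (hX : N.Feasible X) (hZ : N.Feasible Z) (h : X ⊆ Z) (he : e ∈ Z)
    (hl : N.graph.IsLink e x y) (hx : x ∈ V(N.rooted X)) (hy : y ∈ V(N.rooted X)) : e ∈ X := by
  -- Growing `Z` from `X` only adds edges with an end that is new at that moment, so `e` cannot be
  -- among them.
  refine hX.induction_from (motive := fun W => e ∈ W → e ∈ X) hZ h id ?_ he
  intro W f a b _ hXW _ _ hl' _ hb ih hmem
  obtain rfl | hmem := hmem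
  · obtain ⟨-, rfl⟩ | ⟨rfl, -⟩ := hl.eq_and_eq_or_eq_and_eq hl'
    · exact absurd (rooted_verts_mono hXW hy) hb
    · exact absurd (rooted_verts_mono hXW hx) hb
  · exact ih hmem

/-- When the edges of `Y` are added to `X` one by one, an edge whose outer end is already covered is
already present by `mem_of_ends_mem`; this is where the common superset `Z` excludes cycles. -/
theorem union (hX : N.Feasible X) (hY : N.Feasible Y) (hZ : N.Feasible Z) (hXZ : X ⊆ Z)
    (hYZ : Y ⊆ Z) : N.Feasible (X ∪ Y) := by
  induction hY with
  | empty => simpa using hX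
  | @insert Y e x y hY hl hx hy ih =>
    obtain ⟨he, hYZ⟩ := Set.insert_subset_iff.1 hYZ
    specialize ih hYZ
    have hx' : x ∈ V(N.rooted (X ∪ Y)) := rooted_verts_mono Set.subset_union_right hx
    rw [Set.union_insert]
    by_cases hy' : y ∈ V(N.rooted (X ∪ Y))
    · rwa [Set.insert_eq_of_mem
        (ih.mem_of_ends_mem hZ (Set.union_subset hXZ hYZ) he hl hx' hy')]
    · exact ih.insert hl hx' hy'

/-- The vertex identity is what makes prizes modular. It relies on `Z` having no cycles: an edge of
`X` outside `Y` must have its outer end outside `Y`, since otherwise both its ends would be covered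
by `X ∪ Y` without the edge. -/
theorem inter (hX : N.Feasible X) (hY : N.Feasible Y) (hZ : N.Feasible Z) (hXZ : X ⊆ Z)
    (hYZ : Y ⊆ Z) : N.Feasible (X ∩ Y) ∧
      V(N.rooted (X ∩ Y)) = V(N.rooted X) ∩ V(N.rooted Y) := by
  induction hX with
  | empty =>
    rw [Set.empty_inter, rooted_empty_verts]
    refine ⟨.empty, ?_⟩
    rw [Set.inter_eq_left.2 (Set.singleton_subset_iff.2 root_mem_rooted)]
  | @insert X e x y hX hl hx hy ih =>
    obtain ⟨he, hXZ'⟩ := Set.insert_subset_iff.1 hXZ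
    obtain ⟨ih1, ih2⟩ := ih hXZ'
    rw [rooted_insert_verts hl hx]
    by_cases heY : e ∈ Y
    · have hxY : x ∈ V(N.rooted Y) := mem_rooted_of_inc heY hl.inc_left
      have hyY : y ∈ V(N.rooted Y) := mem_rooted_of_inc heY hl.inc_right
      have hx' : x ∈ V(N.rooted (X ∩ Y)) := ih2 ▸ ⟨hx, hxY⟩
      rw [Set.insert_inter_of_mem heY, Set.insert_inter_of_mem hyY, rooted_insert_verts hl hx', ih2]
      refine ⟨ih1.insert hl hx' ?_, rfl⟩
      rw [ih2]
      exact fun h => hy h.1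
    · have hyY : y ∉ V(N.rooted Y) := by
        intro hyY
        have h1 := hX.union hY hZ hXZ' hYZ
        have h2 := h1.mem_of_ends_mem hZ (Set.union_subset hXZ' hYZ) he hl
          (rooted_verts_mono Set.subset_union_left hx)
          (rooted_verts_mono Set.subset_union_right hyY)
        obtain h2 | h2 := h2
        · exact notMem_of_link_notMem hl hy h2
        · exact heY h2
      rw [Set.insert_inter_of_notMem heY, Set.insert_inter_of_notMem hyY]
      exact ⟨ih1, ih2⟩

end Feasible

end Network

/-! ### Walks and paths -/

section Walks

variable {V E : Type} {G H : Graph V E} {u v x : V} {w w' : List (E × V)}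

theorem IsWalk.mono (hGH : G ≤ H) (h : IsWalk G u w v) : IsWalk H u w v := by
  induction h with
  | nil h => exact .nil (hGH.vertexSet_mono h)
  | cons h _ ih => exact .cons (h.mono hGH) ih

theorem IsWalk.append (h : IsWalk G u w v) (h' : IsWalk G v w' x) : IsWalk G u (w ++ w') x := by
  induction h with
  | nil _ => exact h'
  | cons h _ ih => exact .cons h (ih h')

theorem Reachable.trans (h : Reachable G u v) (h' : Reachable G v x) : Reachable G u x := by
  obtain ⟨w, h⟩ := h
  obtain ⟨w', h'⟩ := h'
  exact ⟨w ++ w', h.append h'⟩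

theorem Reachable.symm (h : Reachable G u v) : Reachable G v u := by
  obtain ⟨w, h⟩ := h
  induction h with
  | nil h => exact ⟨[], .nil h⟩
  | cons h _ ih => exact ih.trans ⟨_, .cons h.symm (.nil h.left_mem)⟩

theorem IsWalk.edge_mem (h : IsWalk G u w v) {e : E} (he : e ∈ w.map Prod.fst) : e ∈ E(G) := by
  induction h with
  | nil _ => simp at he
  | cons h _ ih =>
    rw [List.map_cons, List.mem_cons] at he
    obtain rfl | he := he
    · exact h.edge_mem
    · exact ih he

theorem IsWalk.mem_of_inc (h : IsWalk G u w v) {e : E} (he : e ∈ w.map Prod.fst)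
    (hx : G.Inc e x) : x ∈ u :: w.map Prod.snd := by
  induction h with
  | nil _ => simp at he
  | cons h _ ih =>
    rw [List.map_cons, List.mem_cons] at he
    rw [List.map_cons, List.mem_cons]
    obtain rfl | he := he
    · obtain rfl | rfl := hx.eq_or_eq_of_isLink h
      · exact Or.inl rfl
      · exact Or.inr List.mem_cons_self
    · exact Or.inr (ih he)

theorem IsWalk.last_mem (h : IsWalk G u w v) (hw : w ≠ []) : v ∈ w.map Prod.snd := by
  induction h with
  | nil _ => exact absurd rfl hw
  | @cons u v x e w h h' ih =>
    rw [List.map_cons, List.mem_cons]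
    by_cases hw : w = []
    · subst hw
      cases h'
      exact Or.inl rfl
    · exact Or.inr (ih hw)

theorem IsWalk.exists_inc_last (h : IsWalk G u w v) (hne : u ≠ v) : ∃ e, G.Inc e v := by
  induction h with
  | nil _ => exact absurd rfl hne
  | @cons u v x e w h h' ih =>
    by_cases hvx : v = x
    · subst hvx
      exact ⟨e, h.inc_right⟩
    · exact ih hvx

theorem IsWalk.exists_link_leaving (h : IsWalk G u w v) {W : Set V} (hu : u ∈ W) (hv : v ∉ W) :
    ∃ e, ∃ x ∈ W, ∃ y ∉ W, G.IsLink e x y := by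
  induction h with
  | nil _ => exact absurd hu hv
  | @cons u v x e w h h' ih =>
    by_cases hvW : v ∈ W
    · exact ih hvW hv
    · exact ⟨e, u, hu, v, hvW, h⟩

/-- If the first edge recurred later, its tail would be visited again. -/
theorem IsPath.nodup_edges (h : IsPath G u w v) : (w.map Prod.fst).Nodup := by
  obtain ⟨h, hn⟩ := h
  induction h with
  | nil _ => simp
  | @cons u v x e w h h' ih =>
    rw [List.map_cons, List.nodup_cons] at hn ⊢
    refine ⟨fun he => hn.1 ?_, ih hn.2⟩
    exact h'.mem_of_inc he h.inc_left

theorem IsPath.exists_suffix (h : IsPath G u w v) (hx : x ∈ u :: w.map Prod.snd) :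
    ∃ w' ⊆ w, IsPath G x w' v := by
  obtain ⟨h, hn⟩ := h
  induction h with
  | nil h =>
    simp only [List.map_nil, List.mem_singleton] at hx
    subst hx
    exact ⟨[], List.Subset.refl _, .nil h, hn⟩
  | @cons u v z e w h h' ih =>
    rw [List.mem_cons] at hx
    obtain rfl | hx := hx
    · exact ⟨_, List.Subset.refl _, .cons h h', hn⟩
    · obtain ⟨w', hw', hp⟩ := ih hx (List.nodup_cons.1 hn).2
      exact ⟨w', List.subset_cons_of_subset _ hw', hp⟩

theorem IsWalk.exists_isPath (h : IsWalk G u w v) : ∃ w' ⊆ w, IsPath G u w' v := by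
  induction h with
  | nil h => exact ⟨[], List.Subset.refl _, .nil h, by simp⟩
  | @cons u v x e w h h' ih =>
    obtain ⟨w', hw', hp⟩ := ih
    by_cases hu : u ∈ v :: w'.map Prod.snd
    · obtain ⟨w'', hw'', hp'⟩ := hp.exists_suffix hu
      exact ⟨w'', List.subset_cons_of_subset _ (List.Subset.trans hw'' hw'), hp'⟩
    · exact ⟨(e, v) :: w', List.cons_subset_cons _ hw', .cons h hp.1, List.nodup_cons.2 ⟨hu, hp.2⟩⟩

end Walks

/-! ### Feasible sets are the edge sets of rooted subtrees -/

namespace Network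

variable {V E : Type} {N : Network V E} {F O X Y Z S : Set E} {e f : E} {x y v : V}
  {T T' : Graph V E}

theorem rooted_le (hr : N.root ∈ V(N.graph)) : N.rooted F ≤ N.graph where
  vertexSet_mono := by
    rintro v (rfl | ⟨e, _, h⟩)
    · exact hr
    · exact h.vertex_mem
  isLink_mono := fun _ _ _ h => h.2

theorem edgeSet_rooted (h : F ⊆ E(N.graph)) : E(N.rooted F) = F :=
  Set.inter_eq_right.2 h

theorem IsRootedSubtree.mem_iff (h : N.IsRootedSubtree T) :
    v ∈ V(T) ↔ v ∈ V(N.rooted E(T)) := by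
  constructor
  · intro hv
    by_cases hvr : N.root = v
    · exact Or.inl hvr.symm
    · obtain ⟨w, hw⟩ := h.2.1.1.2 _ h.2.2 _ hv
      obtain ⟨e, he⟩ := hw.exists_inc_last hvr
      obtain ⟨y, hy⟩ := he
      exact mem_rooted_of_inc hy.edge_mem (hy.mono h.1).inc_left
  · rintro (rfl | ⟨e, he, hv⟩)
    · exact h.2.2
    · obtain ⟨a, b, hab⟩ := Graph.exists_isLink_of_mem_edgeSet he
      obtain rfl | rfl := hv.eq_or_eq_of_isLink (hab.mono h.1)
      · exact hab.left_mem
      · exact hab.right_mem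

/-- By connectedness every vertex other than the root lies on an edge, so a rooted subtree is
determined by its edge set. -/
theorem IsRootedSubtree.eq_rooted (h : N.IsRootedSubtree T) : T = N.rooted E(T) := by
  refine Graph.ext (Set.ext fun v => h.mem_iff) fun e x y => ?_
  constructor
  · intro hl
    exact ⟨hl.edge_mem, hl.mono h.1⟩
  · rintro ⟨he, hl⟩
    obtain ⟨a, b, hab⟩ := Graph.exists_isLink_of_mem_edgeSet he
    obtain ⟨rfl, rfl⟩ | ⟨rfl, rfl⟩ := hl.eq_and_eq_or_eq_and_eq (hab.mono h.1)
    · exact hab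
    · exact hab.symm

namespace Feasible

/-- The edges of the path form a feasible set themselves, so it can be used as a rooted subtree
later. The last conjunct serves the induction: a new pendant vertex is not on the old path. -/
theorem exists_isPath (hr : N.root ∈ V(N.graph)) (h : N.Feasible F) (hv : v ∈ V(N.rooted F)) :
    ∃ w, IsPath N.graph N.root w v ∧ N.Feasible {e | e ∈ w.map Prod.fst} ∧
      {e | e ∈ w.map Prod.fst} ⊆ F ∧ v ∈ V(N.rooted {e | e ∈ w.map Prod.fst}) ∧
      ∀ z ∈ w.map Prod.snd, z ∈ V(N.rooted F) := by
  induction h generalizing v with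
  | empty =>
    rw [rooted_empty_verts] at hv
    obtain rfl := hv
    refine ⟨[], ⟨.nil hr, by simp⟩, ?_, by simp, Or.inl rfl, by simp⟩
    simpa using Feasible.empty
  | @insert F e x y hF hl hx hy ih =>
    rw [rooted_insert_verts hl hx] at hv ⊢
    obtain rfl | hv := hv
    · obtain ⟨w, hp, hw, hwF, hxw, hz⟩ := ih hx
      have hset : {f | f ∈ (w ++ [(e, v)]).map Prod.fst} =
          Insert.insert e {f | f ∈ w.map Prod.fst} := by
        ext f
        simp only [List.map_append, List.map_cons, List.map_nil, List.mem_append,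
          List.mem_singleton, Set.mem_ofPred_eq, Set.mem_insert_iff]
        tauto
      refine ⟨w ++ [(e, v)], ⟨hp.1.append (.cons hl (.nil hl.right_mem)), ?_⟩, ?_, ?_, ?_, ?_⟩
      · rw [List.map_append, ← List.cons_append, List.nodup_append]
        refine ⟨hp.2, by simp, ?_⟩
        simp only [List.map_cons, List.map_nil, List.mem_singleton, forall_eq]
        rintro a ha rfl
        rw [List.mem_cons] at ha
        obtain rfl | ha := ha
        · exact hy root_mem_rooted
        · exact hy (hz _ ha)
      · rw [hset]
        exact hw.insert hl hxw fun h => hy (rooted_verts_mono hwF h)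
      · rw [hset]
        exact Set.insert_subset_insert hwF
      · rw [hset]
        exact mem_rooted_of_inc (Set.mem_insert _ _) hl.inc_right
      · simp only [List.map_append, List.map_cons, List.map_nil, List.mem_append,
          List.mem_singleton]
        rintro z (h | rfl)
        · exact Or.inr (hz _ h)
        · exact Or.inl rfl
    · obtain ⟨w, hp, hw, hwF, hxw, hz⟩ := ih hv
      exact ⟨w, hp, hw, hwF.trans (Set.subset_insert _ _), hxw, fun z h => Or.inr (hz z h)⟩

theorem reachable_rooted (h : N.Feasible F) (hv : v ∈ V(N.rooted F)) :
    Reachable (N.rooted F) N.root v := by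
  induction h generalizing v with
  | empty =>
    rw [rooted_empty_verts] at hv
    obtain rfl := hv
    exact ⟨[], .nil root_mem_rooted⟩
  | @insert F e x y hF hl hx hy ih =>
    have hle : N.rooted F ≤ N.rooted (Insert.insert e F) :=
      { vertexSet_mono := rooted_verts_mono (Set.subset_insert _ _)
        isLink_mono := fun _ _ _ h => ⟨Or.inr h.1, h.2⟩ }
    have hF' : ∀ z ∈ V(N.rooted F), Reachable (N.rooted (Insert.insert e F)) N.root z := by
      intro z hz
      obtain ⟨w, hw⟩ := ih hz
      exact ⟨w, hw.mono hle⟩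
    rw [rooted_insert_verts hl hx] at hv
    obtain rfl | hv := hv
    · have hl' : (N.rooted (Insert.insert e F)).IsLink e x v := ⟨Or.inl rfl, hl⟩
      exact (hF' x hx).trans ⟨[(e, v)], .cons hl' (.nil hl'.right_mem)⟩
    · exact hF' v hv

/-- A set of `k` vertices spans fewer than `k` edges of a feasible set. -/
theorem ncard_edges_lt [Finite V] [Finite E] (h : N.Feasible F) {W : Set V} (hW : W.Nonempty) :
    {e ∈ F | ∀ x, N.graph.Inc e x → x ∈ W}.ncard < W.ncard := by
  induction h generalizing W with
  | empty =>
    simpa using (Set.ncard_pos (Set.toFinite _)).2 hW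
  | @insert F e x y hF hl hx hy ih =>
    by_cases hyW : y ∈ W
    -- The new vertex `y` meets no edge but `e`, so removing it from `W` loses at most that edge. If
    -- `W` is only `{y}`, it spans no edge at all, since `e` has its other end outside.
    · by_cases hW' : (W \ {y}).Nonempty
      · have hsub : {f ∈ Insert.insert e F | ∀ x, N.graph.Inc f x → x ∈ W} ⊆
            Insert.insert e {f ∈ F | ∀ x, N.graph.Inc f x → x ∈ W \ {y}} := by
          rintro f ⟨rfl | hf, h⟩
          · exact Or.inl rfl
          · refine Or.inr ⟨hf, fun z hz => ⟨h z hz, ?_⟩⟩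
            rintro rfl
            exact hy (mem_rooted_of_inc hf hz)
        have h1 := Set.ncard_le_ncard hsub (Set.toFinite _)
        have h2 := Set.ncard_insert_le e {f ∈ F | ∀ x, N.graph.Inc f x → x ∈ W \ {y}}
        have h3 := ih hW'
        have h4 := Set.ncard_sdiff_singleton_add_one hyW (Set.toFinite _)
        omega
      · have hempty : {f ∈ Insert.insert e F | ∀ x, N.graph.Inc f x → x ∈ W} = ∅ := by
          rw [Set.eq_empty_iff_forall_notMem]
          have hWy : ∀ z ∈ W, z = y := by
            intro z hz
            by_contra hzy
            exact hW' ⟨z, hz, hzy⟩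
          rintro f ⟨rfl | hf, h⟩
          · have := hWy _ (h x hl.inc_left)
            subst this
            exact hy hx
          · obtain ⟨a, b, hab⟩ := Graph.exists_isLink_of_mem_edgeSet (hF.subset hf)
            have := hWy _ (h a hab.inc_left)
            subst this
            exact hy (mem_rooted_of_inc hf hab.inc_left)
        rw [hempty, Set.ncard_empty]
        exact (Set.ncard_pos (Set.toFinite _)).2 hW
    · convert ih hW using 3
      ext f
      constructor
      · rintro ⟨rfl | hf, h⟩
        · exact absurd (h y hl.inc_right) hyW
        · exact ⟨hf, h⟩
      · rintro ⟨hf, h⟩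
        exact ⟨Or.inr hf, h⟩

/-- Acyclicity by counting: a cycle has as many edges as vertices, against `ncard_edges_lt`. -/
theorem isRootedSubtree [Finite V] [Finite E] (hr : N.root ∈ V(N.graph)) (h : N.Feasible F) :
    N.IsRootedSubtree (N.rooted F) := by
  refine ⟨rooted_le hr, ⟨⟨⟨_, root_mem_rooted⟩, ?_⟩, ?_⟩, root_mem_rooted⟩
  · intro u hu v hv
    exact (h.reachable_rooted hu).symm.trans (h.reachable_rooted hv)
  · rintro u w ⟨hw, hwalk, hn1, hn2⟩
    classical
    have hlast := hwalk.last_mem hw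
    have hlt := h.ncard_edges_lt (W := {z | z ∈ w.map Prod.snd}) ⟨u, hlast⟩
    have hsub : {e | e ∈ w.map Prod.fst} ⊆
        {e ∈ F | ∀ x, N.graph.Inc e x → x ∈ {z | z ∈ w.map Prod.snd}} := by
      intro e he
      refine ⟨(hwalk.edge_mem he).2, fun z hz => ?_⟩
      obtain ⟨z', hz'⟩ := hz
      have := hwalk.mem_of_inc he (x := z) ⟨z', (hwalk.edge_mem he).2, hz'⟩
      rw [List.mem_cons] at this
      obtain rfl | this := this
      · exact hlast
      · exact this
    have h1 := Set.ncard_le_ncard hsub (Set.toFinite _)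
    have h2 : {e | e ∈ w.map Prod.fst}.ncard = w.length := by
      rw [← List.coe_toFinset, Set.ncard_coe_finset, List.toFinset_card_of_nodup hn1,
        List.length_map]
    have h3 : {z | z ∈ w.map Prod.snd}.ncard = w.length := by
      rw [← List.coe_toFinset, Set.ncard_coe_finset, List.toFinset_card_of_nodup hn2,
        List.length_map]
    omega

theorem exists_maximal [Finite E] (hF : N.Feasible F) (h : F ⊆ Z) :
    ∃ X, F ⊆ X ∧ X ⊆ Z ∧ N.Feasible X ∧
      ∀ e ∈ Z, ∀ x ∈ V(N.rooted X), ∀ y ∉ V(N.rooted X), ¬ N.graph.IsLink e x y := by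
  obtain ⟨X, hFX, hX⟩ := (Set.toFinite {X | N.Feasible X ∧ X ⊆ Z}).exists_le_maximal
    (show F ∈ {X | N.Feasible X ∧ X ⊆ Z} from ⟨hF, h⟩)
  refine ⟨X, hFX, hX.1.2, hX.1.1, fun e he x hx y hy hl => ?_⟩
  have := hX.2 (y := Insert.insert e X)
    ⟨hX.1.1.insert hl hx hy, Set.insert_subset he hX.1.2⟩ (Set.subset_insert _ _)
  exact notMem_of_link_notMem hl hy (this (Set.mem_insert _ _))

end Feasible

/-- A maximal feasible set of edges of `T` covers all vertices because `T` is connected. It contains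
all edges because a missing one would close a cycle with a path between its ends. -/
theorem IsRootedSubtree.feasible [Finite V] [Finite E] (h : N.IsRootedSubtree T) :
    N.Feasible E(T) := by
  have hr : N.root ∈ V(N.graph) := h.1.vertexSet_mono h.2.2
  obtain ⟨X, -, hXT, hX, hmax⟩ := Feasible.empty.exists_maximal (N := N) (Set.empty_subset E(T))
  suffices hTX : E(T) ⊆ X by rwa [subset_antisymm hTX hXT]
  have hverts : V(T) ⊆ V(N.rooted X) := by
    intro v hv
    by_contra hvX
    obtain ⟨w, hw⟩ := h.2.1.1.2 _ h.2.2 _ hv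
    obtain ⟨e, x, hx, y, hy, hl⟩ := hw.exists_link_leaving root_mem_rooted hvX
    exact hmax e hl.edge_mem x hx y hy (hl.mono h.1)
  intro e he
  by_contra heX
  obtain ⟨x, y, hl⟩ := Graph.exists_isLink_of_mem_edgeSet he
  obtain ⟨w, hw⟩ := (hX.isRootedSubtree hr).2.1.1.2 x (hverts hl.left_mem) y (hverts hl.right_mem)
  obtain ⟨w', -, hp⟩ := hw.exists_isPath
  have hle : N.rooted X ≤ T := by
    rw [h.eq_rooted]
    exact { vertexSet_mono := rooted_verts_mono hXT
            isLink_mono := fun _ _ _ h => ⟨hXT h.1, h.2⟩ }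
  refine h.2.1.2 y ((e, x) :: w') ⟨by simp, .cons hl.symm (hp.1.mono hle), ?_, ?_⟩
  · rw [List.map_cons, List.nodup_cons]
    exact ⟨fun h => heX (hp.1.edge_mem h).2, hp.nodup_edges⟩
  · exact hp.2

end Network

/-! ### Costs and prizes of edge sets -/

namespace Network

variable {V E : Type} {N : Network V E} {F O X Y Z S S' : Set E} {e f : E} {x y v : V}
  {T T' : Graph V E}

/-- The total cost of a set of edges. -/
def setCost (N : Network V E) (F : Set E) : ℝ := ∑ᶠ e ∈ F, N.cost e

/-- The total prize of the vertices that are spanned by the root and a set of edges. -/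
def setPrize (N : Network V E) (F : Set E) : ℝ := N.prizeOf (N.rooted F)

theorem costOf_rooted (h : F ⊆ E(N.graph)) : N.costOf (N.rooted F) = N.setCost F := by
  rw [costOf, edgeSet_rooted h, setCost]

theorem setCost_empty : N.setCost ∅ = 0 := by simp [setCost]

theorem setPrize_empty : N.setPrize ∅ = N.prize N.root := by
  rw [setPrize, prizeOf, rooted_empty_verts, finsum_mem_singleton]

/-- The root is a vertex, costs are positive and prizes are nonnegative. -/
structure Regular (N : Network V E) : Prop where
  root_mem : N.root ∈ V(N.graph)
  cost_pos : ∀ e ∈ E(N.graph), 0 < N.cost e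
  prize_nonneg : ∀ v ∈ V(N.graph), 0 ≤ N.prize v

/-- Some rooted subtree covers all vertices of positive prize. -/
def Coverable (N : Network V E) : Prop :=
  ∃ Z, N.Feasible Z ∧ ∀ v ∈ V(N.graph), 0 < N.prize v → v ∈ V(N.rooted Z)

section Weights

variable [Finite V] [Finite E]

theorem setCost_insert (he : e ∉ F) : N.setCost (insert e F) = N.cost e + N.setCost F :=
  finsum_mem_insert _ he (Set.toFinite _)

theorem setCost_union (h : Disjoint X Y) : N.setCost (X ∪ Y) = N.setCost X + N.setCost Y :=
  finsum_mem_union h (Set.toFinite _) (Set.toFinite _)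

theorem setCost_union_inter :
    N.setCost (X ∪ Y) + N.setCost (X ∩ Y) = N.setCost X + N.setCost Y :=
  finsum_mem_union_inter (Set.toFinite _) (Set.toFinite _)

theorem Regular.setCost_nonneg (hN : N.Regular) (h : F ⊆ E(N.graph)) : 0 ≤ N.setCost F :=
  finsum_nonneg fun e => finsum_nonneg fun he => (hN.cost_pos e (h he)).le

theorem Regular.setCost_pos (hN : N.Regular) (h : F ⊆ E(N.graph)) (hne : F.Nonempty) :
    0 < N.setCost F := by
  obtain ⟨e, he⟩ := hne
  have hF : F = insert e (F \ {e}) := by simp [Set.insert_eq_of_mem he]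
  rw [hF, setCost_insert (by simp)]
  have := hN.setCost_nonneg (Set.sdiff_subset.trans h : F \ {e} ⊆ _)
  have := hN.cost_pos e (h he)
  linarith

theorem setCost_sdiff (h : X ⊆ Y) : N.setCost (Y \ X) = N.setCost Y - N.setCost X := by
  have := setCost_union (N := N) (disjoint_sdiff_self_right : Disjoint X (Y \ X))
  rw [Set.union_sdiff_cancel h] at this
  linarith

theorem Regular.setCost_lt (hN : N.Regular) (hY : Y ⊆ E(N.graph)) (h : X ⊂ Y) :
    N.setCost X < N.setCost Y := by
  have := hN.setCost_pos (Set.sdiff_subset.trans hY : Y \ X ⊆ _) (Set.nonempty_of_ssubset h)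
  rw [setCost_sdiff h.1] at this
  linarith

theorem Regular.setCost_mono (hN : N.Regular) (hY : Y ⊆ E(N.graph)) (h : X ⊆ Y) :
    N.setCost X ≤ N.setCost Y := by
  obtain rfl | h := h.eq_or_ssubset
  · exact le_rfl
  · exact (hN.setCost_lt hY h).le

/-- Modularity of the prize, available because the vertex sets of two feasible subsets of `Z`
intersect exactly in the vertices of the intersection. -/
theorem Feasible.setPrize_union_inter (hX : N.Feasible X) (hY : N.Feasible Y)
    (hZ : N.Feasible Z) (hXZ : X ⊆ Z) (hYZ : Y ⊆ Z) :
    N.setPrize (X ∪ Y) + N.setPrize (X ∩ Y) = N.setPrize X + N.setPrize Y := by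
  rw [setPrize, setPrize, prizeOf, prizeOf, rooted_union_verts, (hX.inter hY hZ hXZ hYZ).2]
  exact finsum_mem_union_inter (Set.toFinite _) (Set.toFinite _)

theorem sum_sdiff_of_subset {A B : Set V} {g : V → ℝ} (h : A ⊆ B) :
    ∑ᶠ v ∈ B \ A, g v = ∑ᶠ v ∈ B, g v - ∑ᶠ v ∈ A, g v := by
  have := finsum_mem_union (f := g) (disjoint_sdiff_self_right : Disjoint A (B \ A))
    (Set.toFinite _) (Set.toFinite _)
  rw [Set.union_sdiff_cancel h] at this
  linarith

theorem sum_le_sum_of_subset {A B : Set V} {g : V → ℝ} (h : A ⊆ B) (hg : ∀ v ∈ B, 0 ≤ g v) :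
    ∑ᶠ v ∈ A, g v ≤ ∑ᶠ v ∈ B, g v := by
  have h1 := sum_sdiff_of_subset (g := g) h
  have h2 : 0 ≤ ∑ᶠ v ∈ B \ A, g v := finsum_nonneg fun v => finsum_nonneg fun hv => hg v hv.1
  linarith

theorem Regular.setPrize_mono_verts (hN : N.Regular) (h : V(N.rooted X) ⊆ V(N.rooted Y)) :
    N.setPrize X ≤ N.setPrize Y :=
  sum_le_sum_of_subset h fun v hv =>
    hN.prize_nonneg v ((rooted_le hN.root_mem).vertexSet_mono hv)

theorem Regular.setPrize_mono (hN : N.Regular) (h : X ⊆ Y) : N.setPrize X ≤ N.setPrize Y :=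
  hN.setPrize_mono_verts (rooted_verts_mono h)

theorem Regular.setPrize_nonneg (hN : N.Regular) : 0 ≤ N.setPrize X :=
  finsum_nonneg fun v => finsum_nonneg fun hv => hN.prize_nonneg v ((rooted_le hN.root_mem).vertexSet_mono hv)

theorem Regular.setPrize_le_totalPrize (hN : N.Regular) : N.setPrize X ≤ N.totalPrize :=
  sum_le_sum_of_subset (rooted_le hN.root_mem).vertexSet_mono hN.prize_nonneg

end Weights

/-! ### Contraction as passage to marginal values -/

section Contraction

theorem collapse_of_mem {A : Set V} {r : V} (h : v ∈ A) : collapse A r v = r := if_pos h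

theorem collapse_of_notMem {A : Set V} {r : V} (h : v ∉ A) : collapse A r v = v := if_neg h

theorem contract_isLink (hF : F ⊆ E(N.graph)) :
    (N.contract (N.rooted F)).graph.IsLink e x y ↔ e ∉ F ∧ ∃ a b, N.graph.IsLink e a b ∧
      collapse V(N.rooted F) N.root a = x ∧ collapse V(N.rooted F) N.root b = y := by
  simp only [contract, Graph.map_isLink, Relation.Map, Graph.deleteEdges_isLink, edgeSet_rooted hF]
  constructor
  · rintro ⟨a, b, ⟨h, he⟩, h1, h2⟩
    exact ⟨he, a, b, h, h1, h2⟩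
  · rintro ⟨he, a, b, h, h1, h2⟩
    exact ⟨a, b, ⟨h, he⟩, h1, h2⟩

theorem contract_edgeSet (hF : F ⊆ E(N.graph)) :
    E((N.contract (N.rooted F)).graph) = E(N.graph) \ F := by
  simp [contract, edgeSet_rooted hF]

theorem contract_vertexSet (hr : N.root ∈ V(N.graph)) :
    V((N.contract (N.rooted F)).graph) = insert N.root (V(N.graph) \ V(N.rooted F)) := by
  ext v
  simp only [contract, Graph.vertexSet_map, Graph.vertexSet_deleteEdges, Set.mem_image,
    Set.mem_insert_iff, Set.mem_sdiff]
  constructor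
  · rintro ⟨a, ha, rfl⟩
    by_cases haF : a ∈ V(N.rooted F)
    · exact Or.inl (collapse_of_mem haF)
    · rw [collapse_of_notMem haF]
      exact Or.inr ⟨ha, haF⟩
  · rintro (rfl | ⟨h, hF⟩)
    · exact ⟨_, hr, collapse_of_mem root_mem_rooted⟩
    · exact ⟨v, h, collapse_of_notMem hF⟩

theorem contract_rooted_verts (hF : F ⊆ E(N.graph)) (h : Disjoint S F) :
    V((N.contract (N.rooted F)).rooted S) =
      insert N.root (V(N.rooted (F ∪ S)) \ V(N.rooted F)) := by
  ext v
  rw [mem_rooted]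
  constructor
  · rintro (rfl | ⟨e, he, z, hz⟩)
    · exact Or.inl rfl
    · rw [contract_isLink hF] at hz
      obtain ⟨heF, a, b, hab, rfl, -⟩ := hz
      by_cases ha : a ∈ V(N.rooted F)
      · exact Or.inl (collapse_of_mem ha)
      · rw [collapse_of_notMem ha]
        exact Or.inr ⟨mem_rooted_of_inc (Or.inr he) hab.inc_left, ha⟩
  · rintro (rfl | ⟨hv, hvF⟩)
    · exact Or.inl rfl
    · rw [rooted_union_verts] at hv
      obtain hv | hv := hv
      · exact absurd hv hvF
      · obtain rfl | ⟨e, he, z, hz⟩ := hv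
        · exact absurd root_mem_rooted hvF
        · refine Or.inr ⟨e, he, collapse V(N.rooted F) N.root z, (contract_isLink hF).2
            ⟨Set.disjoint_left.1 h he, v, z, hz, collapse_of_notMem hvF, rfl⟩⟩

variable [Finite V] [Finite E]

/-- Pendant edges correspond on both sides: an end inside `F` becomes the contracted root, every
other vertex is unchanged. All statements about contracted networks are translated back to `N`
through this. -/
theorem feasible_contract_iff (hF : N.Feasible F) :
    (N.contract (N.rooted F)).Feasible S ↔ Disjoint S F ∧ N.Feasible (F ∪ S) := by
  constructor
  · intro h
    induction h with
    | empty => simpa using hF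
    | @insert S e x y hS hl hx hy ih =>
      obtain ⟨hd, ih⟩ := ih
      rw [contract_rooted_verts hF.subset hd] at hx hy
      rw [contract_isLink hF.subset] at hl
      obtain ⟨heF, a, b, hab, rfl, rfl⟩ := hl
      refine ⟨Set.disjoint_insert_left.2 ⟨heF, hd⟩, ?_⟩
      rw [Set.union_insert]
      refine ih.insert hab (x := a) (y := b) ?_ ?_
      · by_cases ha : a ∈ V(N.rooted F)
        · exact rooted_verts_mono Set.subset_union_left ha
        · rw [collapse_of_notMem ha] at hx
          obtain rfl | hx := hx
          · exact root_mem_rooted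
          · exact hx.1
      · intro hb
        by_cases hb' : b ∈ V(N.rooted F)
        · exact hy (Or.inl (collapse_of_mem hb'))
        · rw [collapse_of_notMem hb'] at hy
          exact hy (Or.inr ⟨hb, hb'⟩)
  · rintro ⟨hd, h⟩
    have hS : (F ∪ S) \ F = S := by
      rw [Set.union_sdiff_left]
      exact hd.sdiff_eq_left
    rw [← hS]
    refine hF.induction_from (motive := fun W => (N.contract (N.rooted F)).Feasible (W \ F)) h
      Set.subset_union_left (by simpa using Feasible.empty) ?_
    intro W e x y hW hFW _ _ hl hx hy ih
    have heF : e ∉ F := fun h => notMem_of_link_notMem hl hy (hFW h)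
    have hyF : y ∉ V(N.rooted F) := fun h => hy (rooted_verts_mono hFW h)
    rw [Set.insert_sdiff_of_notMem _ heF]
    have hverts := contract_rooted_verts (S := W \ F) hF.subset disjoint_sdiff_self_left
    rw [Set.union_sdiff_cancel hFW] at hverts
    refine ih.insert (x := collapse V(N.rooted F) N.root x) (y := y)
      ((contract_isLink hF.subset).2 ⟨heF, x, y, hl, rfl, collapse_of_notMem hyF⟩) ?_ ?_
    · rw [hverts]
      by_cases hxF : x ∈ V(N.rooted F)
      · exact Or.inl (collapse_of_mem hxF)
      · rw [collapse_of_notMem hxF]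
        exact Or.inr ⟨hx, hxF⟩
    · rw [hverts]
      rintro (rfl | h)
      · exact hyF root_mem_rooted
      · exact hy h.1

theorem sum_contract_prize {A : Set V} (hr : N.root ∉ A) :
    ∑ᶠ v ∈ insert N.root A, (N.contract T).prize v = ∑ᶠ v ∈ A, N.prize v := by
  rw [finsum_mem_insert _ hr (Set.toFinite _)]
  have h1 : (N.contract T).prize N.root = 0 := if_pos rfl
  rw [h1, zero_add]
  refine finsum_mem_congr rfl fun v hv => if_neg ?_
  rintro rfl
  exact hr hv

theorem setPrize_contract (hF : F ⊆ E(N.graph)) (h : Disjoint S F) :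
    (N.contract (N.rooted F)).setPrize S = N.setPrize (F ∪ S) - N.setPrize F := by
  rw [setPrize, prizeOf, contract_rooted_verts hF h, sum_contract_prize,
    sum_sdiff_of_subset (rooted_verts_mono Set.subset_union_left)]
  · rfl
  · exact fun h => h.2 root_mem_rooted

theorem totalPrize_contract (hr : N.root ∈ V(N.graph)) :
    (N.contract (N.rooted F)).totalPrize = N.totalPrize - N.setPrize F := by
  rw [totalPrize, prizeOf, contract_vertexSet hr, sum_contract_prize,
    sum_sdiff_of_subset (rooted_le hr).vertexSet_mono]
  · rfl
  · exact fun h => h.2 root_mem_rooted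

theorem setCost_contract : (N.contract T).setCost S = N.setCost S := rfl

theorem prize_root_contract : (N.contract T).prize (N.contract T).root = 0 := if_pos rfl

theorem Regular.contract (hN : N.Regular) (hF : F ⊆ E(N.graph)) :
    (N.contract (N.rooted F)).Regular where
  root_mem := by
    rw [contract_vertexSet hN.root_mem]
    exact Or.inl rfl
  cost_pos := by
    rw [contract_edgeSet hF]
    exact fun e he => hN.cost_pos e he.1
  prize_nonneg := by
    rw [contract_vertexSet hN.root_mem]
    intro v hv
    by_cases h : v = N.root
    · exact (show (N.contract (N.rooted F)).prize v = 0 from if_pos h).ge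
    · rw [show (N.contract (N.rooted F)).prize v = N.prize v from if_neg h]
      exact hN.prize_nonneg v (hv.resolve_left h).1

/-- The covering set is replaced by an extension of `F` with some of its edges, and `F` is then
removed. -/
theorem Coverable.contract (hr : N.root ∈ V(N.graph)) (h : N.Coverable) (hF : N.Feasible F) :
    (N.contract (N.rooted F)).Coverable := by
  obtain ⟨Z, hZ, hcov⟩ := h
  obtain ⟨S, -, hS, hv⟩ := hF.exists_extension hZ
  have hU : F ∪ S \ F = F ∪ S := Set.union_sdiff_self
  refine ⟨S \ F, (feasible_contract_iff hF).2 ⟨disjoint_sdiff_self_left, ?_⟩, ?_⟩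
  · rwa [hU]
  · intro v hvM hp
    have hvr : v ≠ N.root := by
      rintro rfl
      rw [show (N.contract (N.rooted F)).prize N.root = 0 from if_pos rfl] at hp
      exact lt_irrefl _ hp
    rw [contract_vertexSet hr] at hvM
    obtain ⟨hvG, hvF⟩ := hvM.resolve_left hvr
    rw [contract_rooted_verts hF.subset disjoint_sdiff_self_left, hU]
    refine Or.inr ⟨hv (hcov v hvG ?_), hvF⟩
    rwa [show (N.contract (N.rooted F)).prize v = N.prize v from if_neg hvr] at hp

end Contraction

/-! ### Restriction to a rooted subtree -/

section Restriction

theorem restrictTo_rooted_verts (h : S' ⊆ S) :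
    V((N.restrictTo (N.rooted S)).rooted S') = V(N.rooted S') := by
  ext v
  constructor
  · rintro (rfl | ⟨e, he, y, hy⟩)
    · exact root_mem_rooted
    · exact mem_rooted_of_inc he ⟨y, hy.2⟩
  · rintro (rfl | ⟨e, he, y, hy⟩)
    · exact Or.inl rfl
    · exact Or.inr ⟨e, he, y, h he, hy⟩

theorem feasible_restrictTo_iff :
    (N.restrictTo (N.rooted S)).Feasible S' ↔ N.Feasible S' ∧ S' ⊆ S := by
  constructor
  · intro h
    induction h with
    | empty => exact ⟨.empty, Set.empty_subset _⟩
    | insert _ hl hx hy ih =>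
      rw [restrictTo_rooted_verts ih.2] at hx hy
      exact ⟨ih.1.insert hl.2 hx hy, Set.insert_subset hl.1 ih.2⟩
  · rintro ⟨h, hS⟩
    induction h with
    | empty => exact .empty
    | insert hF hl hx hy ih =>
      obtain ⟨he, hS⟩ := Set.insert_subset_iff.1 hS
      refine (ih hS).insert (show (N.rooted S).IsLink _ _ _ from ⟨he, hl⟩) ?_ ?_
      · rwa [restrictTo_rooted_verts hS]
      · rwa [restrictTo_rooted_verts hS]

theorem setPrize_restrictTo (h : S' ⊆ S) :
    (N.restrictTo (N.rooted S)).setPrize S' = N.setPrize S' := by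
  rw [setPrize, prizeOf, restrictTo_rooted_verts h]
  rfl

theorem totalPrize_restrictTo : (N.restrictTo (N.rooted S)).totalPrize = N.setPrize S := rfl

theorem Regular.restrictTo (hN : N.Regular) : (N.restrictTo (N.rooted S)).Regular where
  root_mem := root_mem_rooted
  cost_pos := fun e he => hN.cost_pos e he.1
  prize_nonneg := fun v hv => hN.prize_nonneg v ((rooted_le hN.root_mem).vertexSet_mono hv)

theorem Coverable.restrictTo (h : N.Feasible S) : (N.restrictTo (N.rooted S)).Coverable :=
  ⟨S, feasible_restrictTo_iff.2 ⟨h, subset_rfl⟩, fun v hv _ => by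
    rw [restrictTo_rooted_verts subset_rfl]
    exact hv⟩

end Restriction

end Network

/-! ### Min-max subtrees as edge sets -/

namespace Network

variable {V E : Type} {N : Network V E} {F O X Y Z S S' : Set E} {e f : E} {x y v : V}
  {T T' : Graph V E} [Finite V] [Finite E] {lam : ℝ}

/-- The edge sets of min-max subtrees of positive density `lam`, in a network whose root has
prize `0`. -/
structure MinMaxSet (N : Network V E) (S : Set E) (lam : ℝ) : Prop where
  feasible : N.Feasible S
  pos : 0 < lam
  eq : N.setPrize S = lam * N.setCost S
  le : ∀ Y, N.Feasible Y → N.setPrize Y ≤ lam * N.setCost Y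
  lt : ∀ Y, N.Feasible Y → Y.Nonempty → Y ⊂ S → N.setPrize Y < lam * N.setCost Y

/-- Ensures that a nonzero total prize can actually be collected by a rooted subtree, so that the
maximum density is positive. -/
theorem Coverable.exists_setPrize_eq (h : N.Coverable) (hN : N.Regular) :
    ∃ Z, N.Feasible Z ∧ N.setPrize Z = N.totalPrize := by
  obtain ⟨Z, hZ, hcov⟩ := h
  refine ⟨Z, hZ, ?_⟩
  have h1 := sum_sdiff_of_subset (g := N.prize) (rooted_le (F := Z) hN.root_mem).vertexSet_mono
  have h2 : ∑ᶠ v ∈ V(N.graph) \ V(N.rooted Z), N.prize v = 0 := by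
    refine finsum_mem_eq_zero_of_forall_eq_zero fun v hv => ?_
    by_contra hne
    exact hv.2 (hcov v hv.1 (lt_of_le_of_ne (hN.prize_nonneg v hv.1) (Ne.symm hne)))
  rw [h2] at h1
  exact (sub_eq_zero.1 h1.symm).symm

theorem density_rooted (h : F ⊆ E(N.graph)) :
    N.density (N.rooted F) = N.setPrize F / N.setCost F := by
  rw [density, costOf_rooted h, setPrize]

/-- Maximality gives the inequality for all feasible sets, once the empty one is handled by the zero
prize of the root; inclusion-minimality makes it strict on proper nonempty subsets. -/
theorem IsMinMax.exists_set (h : N.IsMinMax T) (hN : N.Regular) (hcov : N.Coverable)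
    (hroot : N.prize N.root = 0) (htot : N.totalPrize ≠ 0) :
    ∃ S lam, T = N.rooted S ∧ S.Nonempty ∧ N.MinMaxSet S lam := by
  obtain ⟨⟨hT, hmax⟩, hmin⟩ := h
  have hS := hT.feasible
  have hTS := hT.eq_rooted
  set S := E(T) with hSdef
  clear_value S
  subst hTS
  have hempty : N.setPrize ∅ = 0 := by rw [setPrize_empty, hroot]
  obtain ⟨Z, hZ, hZt⟩ := hcov.exists_setPrize_eq hN
  have hZpos : 0 < N.setPrize Z :=
    lt_of_le_of_ne hN.setPrize_nonneg (by rw [hZt]; exact Ne.symm htot)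
  have hZne : Z.Nonempty := by
    rw [Set.nonempty_iff_ne_empty]
    rintro rfl
    exact hZpos.ne' hempty
  have hlam : 0 < N.density (N.rooted S) := by
    refine lt_of_lt_of_le ?_ (hmax _ (hZ.isRootedSubtree hN.root_mem))
    rw [density_rooted hZ.subset]
    exact div_pos hZpos (hN.setCost_pos hZ.subset hZne)
  -- The edgeless tree has density 0 by the convention for division by zero.
  have hSne : S.Nonempty := by
    rw [Set.nonempty_iff_ne_empty]
    rintro rfl
    rw [density_rooted hS.subset, setCost_empty, div_zero] at hlam
    exact lt_irrefl _ hlam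
  have hScost := hN.setCost_pos hS.subset hSne
  have hle : ∀ Y, N.Feasible Y → N.setPrize Y ≤ N.density (N.rooted S) * N.setCost Y := by
    intro Y hY
    obtain rfl | hne := Y.eq_empty_or_nonempty
    · rw [hempty, setCost_empty, mul_zero]
    · rw [← div_le_iff₀ (hN.setCost_pos hY.subset hne), ← density_rooted hY.subset]
      exact hmax _ (hY.isRootedSubtree hN.root_mem)
  refine ⟨S, N.density (N.rooted S), rfl, hSne, hS, hlam, ?_, hle, ?_⟩
  · rw [density_rooted hS.subset, div_mul_cancel₀ _ hScost.ne']
  · intro Y hY hne hYS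
    refine lt_of_le_of_ne (hle Y hY) fun heq => hYS.2 ?_
    have hdens : N.density (N.rooted Y) = N.density (N.rooted S) := by
      rw [density_rooted hY.subset, heq,
        mul_div_cancel_right₀ _ (hN.setCost_pos hY.subset hne).ne']
    have hle' : N.rooted Y ≤ N.rooted S :=
      { vertexSet_mono := rooted_verts_mono hYS.1
        isLink_mono := fun _ _ _ h => ⟨hYS.1 h.1, h.2⟩ }
    have := hmin ⟨hY.isRootedSubtree hN.root_mem, by rw [hdens]; exact hmax⟩ hle'
    have := this.edgeSet_mono
    rwa [edgeSet_rooted hS.subset, edgeSet_rooted hY.subset] at this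

theorem exists_isMinMax (hr : N.root ∈ V(N.graph)) : ∃ T, N.IsMinMax T := by
  have hfin : {T | N.IsRootedSubtree T}.Finite := by
    refine (Set.finite_range N.rooted).subset ?_
    rintro T hT
    exact ⟨E(T), (IsRootedSubtree.eq_rooted hT).symm⟩
  obtain ⟨T, hT, hmax⟩ := Set.exists_max_image _ N.density hfin
    ⟨_, Feasible.empty.isRootedSubtree hr⟩
  have hfin' : {T | N.HasMaxDensity T}.Finite := hfin.subset fun T h => h.1
  obtain ⟨T', -, hT'⟩ := hfin'.exists_le_minimal (show T ∈ {T | N.HasMaxDensity T} from ⟨hT, hmax⟩)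
  exact ⟨T', hT'⟩

/-- An edge of a feasible set at the root is not a loop: otherwise `mem_of_ends_mem` would put it
into the empty set. -/
theorem feasible_singleton (hS : N.Feasible S) (he : e ∈ S) (h : N.graph.Inc e N.root) :
    N.Feasible {e} := by
  obtain ⟨y, hl⟩ := h
  have hy : y ∉ V(N.rooted (∅ : Set E)) := by
    intro hy
    exact Feasible.empty.mem_of_ends_mem hS (Set.empty_subset _) he hl root_mem_rooted hy
  have := Feasible.empty.insert hl root_mem_rooted hy
  rwa [insert_empty_eq] at this

theorem inc_root_of_feasible_singleton (h : N.Feasible {e}) : N.graph.Inc e N.root := by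
  obtain ⟨f, rfl, -, x, hx, y, hy, hl⟩ := Feasible.empty.exists_insert h
    (Set.empty_ssubset.2 (Set.singleton_nonempty e))
  rw [rooted_empty_verts] at hx
  obtain rfl := hx
  exact hl.inc_left

/-- A feasible set with two edges at the root is a disjoint union of two nonempty feasible sets. -/
theorem Feasible.exists_branches (hS : N.Feasible S) (he : e ∈ S) (hf : f ∈ S) (hef : e ≠ f)
    (her : N.graph.Inc e N.root) (hfr : N.graph.Inc f N.root) :
    ∃ X Y, N.Feasible X ∧ N.Feasible Y ∧ f ∈ X ∧ e ∈ Y ∧ Disjoint X Y ∧ X ∪ Y = S := by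
  obtain ⟨X, hfX, hXS, hX, hXmax⟩ := (feasible_singleton hS hf hfr).exists_maximal
    (Z := S \ {e}) (by simpa using ⟨hf, hef.symm⟩)
  have heX : e ∉ X := fun h => (hXS h).2 rfl
  obtain ⟨Y, heY, hYS, hY, hYmax⟩ := (feasible_singleton hS he her).exists_maximal
    (Z := S \ X) (by simpa using ⟨he, heX⟩)
  have hXS' : X ⊆ S := hXS.trans Set.sdiff_subset
  have hYS' : Y ⊆ S := hYS.trans Set.sdiff_subset
  refine ⟨X, Y, hX, hY, hfX rfl, heY rfl, (Set.subset_sdiff.1 hYS).2.symm, ?_⟩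
  by_contra hne
  obtain ⟨g, hg, hgU, x, hx, y, hy, hl⟩ := (hX.union hY hS hXS' hYS').exists_insert hS
    ((Set.union_subset hXS' hYS').ssubset_of_ne hne)
  rw [rooted_union_verts] at hx hy
  obtain hx | hx := hx
  · refine hXmax g ⟨hg, ?_⟩ x hx y (fun h => hy (Or.inl h)) hl
    rintro rfl
    exact hgU (Or.inr (heY rfl))
  · exact hYmax g ⟨hg, fun h => hgU (Or.inl h)⟩ x hx y (fun h => hy (Or.inr h)) hl

/-- Two root edges would split `S` into two smaller branches, each of density below `lam`, and by
modularity their values add up to those of `S`. -/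
theorem MinMaxSet.eq_of_inc_root (h : N.MinMaxSet S lam) (hroot : N.prize N.root = 0)
    (he : e ∈ S) (hf : f ∈ S) (her : N.graph.Inc e N.root) (hfr : N.graph.Inc f N.root) :
    e = f := by
  by_contra hef
  obtain ⟨X, Y, hX, hY, hfX, heY, hd, hU⟩ := h.feasible.exists_branches he hf hef her hfr
  have hXS : X ⊆ S := hU ▸ Set.subset_union_left
  have hYS : Y ⊆ S := hU ▸ Set.subset_union_right
  have h1 := h.lt X hX ⟨f, hfX⟩ (hXS.ssubset_of_ne (by
    rintro rfl
    exact Set.disjoint_left.1 hd he heY))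
  have h2 := h.lt Y hY ⟨e, heY⟩ (hYS.ssubset_of_ne (by
    rintro rfl
    exact Set.disjoint_left.1 hd hfX hf))
  have h3 := hX.setPrize_union_inter hY h.feasible hXS hYS
  have h4 := setCost_union (N := N) hd
  rw [hU, Set.disjoint_iff_inter_eq_empty.1 hd, setPrize_empty, hroot, h.eq] at h3
  rw [hU] at h4
  rw [h4] at h3
  linarith

theorem Feasible.exists_inc_root (hS : N.Feasible S) (hne : S.Nonempty) :
    ∃ e ∈ S, N.graph.Inc e N.root := by
  obtain ⟨e, he, -, x, hx, y, hy, hl⟩ := Feasible.empty.exists_insert hS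
    (Set.empty_ssubset.2 hne)
  rw [rooted_empty_verts] at hx
  obtain rfl := hx
  exact ⟨e, he, hl.inc_left⟩

theorem inc_rooted_iff : (N.rooted S).Inc e v ↔ e ∈ S ∧ N.graph.Inc e v :=
  ⟨fun ⟨y, h⟩ => ⟨h.1, y, h.2⟩, fun ⟨h, y, hy⟩ => ⟨y, h, hy⟩⟩

/-- On a contracted network, the tree that is formed by the edges of a min-max subtree is that
subtree itself. -/
theorem contractSub_extension (hF : F ⊆ E(N.graph)) (hS : (N.contract (N.rooted F)).Feasible S)
    (hne : S.Nonempty) :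
    N.contractSub (N.extension ((N.contract (N.rooted F)).rooted S)) (N.rooted F) =
      (N.contract (N.rooted F)).rooted S := by
  have hSE := hS.subset
  have hSF : S ⊆ E(N.graph) \ F := by rwa [contract_edgeSet hF] at hSE
  have hset : E(N.extension ((N.contract (N.rooted F)).rooted S)) \ E(N.rooted F) = S := by
    have : E(N.extension ((N.contract (N.rooted F)).rooted S)) =
      E(N.graph) ∩ E((N.contract (N.rooted F)).rooted S) := rfl
    rw [this, edgeSet_rooted hSE, edgeSet_rooted hF,
      Set.inter_eq_right.2 (hSF.trans Set.sdiff_subset)]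
    exact (Set.subset_sdiff.1 hSF).2.sdiff_eq_left
  rw [contractSub, hset]
  refine Graph.ext ?_ fun _ _ _ => Iff.rfl
  ext v
  constructor
  · rintro (h | h)
    · exact h.elim
    · exact Or.inr h
  · rintro (rfl | h)
    -- An edge-induced subgraph contains the root only if some edge meets it; this is why `S` has to
    -- be nonempty.
    · obtain ⟨e, he, h⟩ := hS.exists_inc_root hne
      exact Or.inr ⟨e, he, h⟩
    · exact Or.inr h

theorem edgeSet_extension (hF : F ⊆ E(N.graph)) (hS : (N.contract (N.rooted F)).Feasible S) :
    E(N.extension ((N.contract (N.rooted F)).rooted S)) = S := by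
  have hSE := hS.subset
  have : E(N.extension ((N.contract (N.rooted F)).rooted S)) =
    E(N.graph) ∩ E((N.contract (N.rooted F)).rooted S) := rfl
  rw [this, edgeSet_rooted hSE]
  rw [contract_edgeSet hF] at hSE
  exact Set.inter_eq_right.2 (hSE.trans Set.sdiff_subset)

end Network

/-! ### Runs of the algorithm for trees -/

namespace Network

variable {V E : Type} {N : Network V E} {F O X Y Z S S' X' : Set E} {e f : E} {x y v : V}
  {T T' : Graph V E} [Finite V] [Finite E] {lam lam' d : ℝ} {π : List E}

/-- The edge sets of min-max subtrees of positive density `lam` in the network in which the rooted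
tree with edge set `X` is contracted. -/
structure RelMinMax (N : Network V E) (X S : Set E) (lam : ℝ) : Prop where
  base : N.Feasible X
  feasible : N.Feasible (X ∪ S)
  disjoint : Disjoint S X
  pos : 0 < lam
  eq : N.setPrize (X ∪ S) - N.setPrize X = lam * (N.setCost (X ∪ S) - N.setCost X)
  le : ∀ Y, N.Feasible Y → X ⊆ Y →
    N.setPrize Y - N.setPrize X ≤ lam * (N.setCost Y - N.setCost X)
  lt : ∀ Y, N.Feasible Y → X ⊂ Y → Y ⊂ X ∪ S →
    N.setPrize Y - N.setPrize X < lam * (N.setCost Y - N.setCost X)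

theorem feasible_contract_sdiff (hX : N.Feasible X) (hY : N.Feasible Y) (h : X ⊆ Y) :
    (N.contract (N.rooted X)).Feasible (Y \ X) := by
  rw [feasible_contract_iff hX, Set.union_sdiff_cancel h]
  exact ⟨disjoint_sdiff_self_left, hY⟩

theorem setPrize_contract_sdiff (hX : N.Feasible X) (h : X ⊆ Y) :
    (N.contract (N.rooted X)).setPrize (Y \ X) = N.setPrize Y - N.setPrize X := by
  rw [setPrize_contract hX.subset disjoint_sdiff_self_left, Set.union_sdiff_cancel h]

theorem MinMaxSet.relMinMax (hX : N.Feasible X)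
    (h : (N.contract (N.rooted X)).MinMaxSet S lam) : N.RelMinMax X S lam := by
  obtain ⟨hd, hf⟩ := (feasible_contract_iff hX).1 h.feasible
  refine ⟨hX, hf, hd, h.pos, ?_, ?_, ?_⟩
  · rw [← setPrize_contract hX.subset hd, h.eq, setCost_contract, setCost_union hd.symm]
    ring
  · intro Y hY hXY
    have := h.le _ (feasible_contract_sdiff hX hY hXY)
    rwa [setPrize_contract_sdiff hX hXY, setCost_contract, setCost_sdiff hXY] at this
  · intro Y hY hXY hYS
    have := h.lt _ (feasible_contract_sdiff hX hY hXY.1) (Set.nonempty_of_ssubset hXY) ?_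
    · rwa [setPrize_contract_sdiff hX hXY.1, setCost_contract, setCost_sdiff hXY.1] at this
    · refine ⟨fun f hf => (hYS.1 hf.1).resolve_left hf.2, fun hS => hYS.2 ?_⟩
      exact Set.union_subset hXY.1 (hS.trans Set.sdiff_subset)

theorem IsMinMax.exists_relMinMax (hN : N.Regular) (hcov : N.Coverable) (hX : N.Feasible X)
    (htot : (N.contract (N.rooted X)).totalPrize ≠ 0)
    (h : (N.contract (N.rooted X)).IsMinMax T) :
    ∃ S lam, T = (N.contract (N.rooted X)).rooted S ∧ S.Nonempty ∧
      (N.contract (N.rooted X)).MinMaxSet S lam ∧ N.RelMinMax X S lam := by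
  obtain ⟨S, lam, hT, hne, hS⟩ := h.exists_set (hN.contract hX.subset)
    (hcov.contract hN.root_mem hX) prize_root_contract htot
  exact ⟨S, lam, hT, hne, hS, hS.relMinMax hX⟩

theorem feasible_insert_iff (hX : N.Feasible X) (he : e ∉ X) :
    N.Feasible (insert e X) ↔ (N.contract (N.rooted X)).Feasible {e} := by
  rw [feasible_contract_iff hX, Set.union_singleton, Set.disjoint_singleton_left]
  exact ⟨fun h => ⟨he, h⟩, fun h => h.2⟩

theorem setOf_mem_append_singleton : {f | f ∈ π ++ [e]} = insert e {f | f ∈ π} := by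
  ext f
  simp [or_comm]

/-- The edge that a step of the algorithm for trees appends. -/
theorem RelMinMax.step (hN : N.Regular) (hcov : N.Coverable) (hX : N.Feasible X)
    (htot : (N.contract (N.rooted X)).totalPrize ≠ 0)
    (h : (N.contract (N.rooted X)).IsMinMax T) (he : T.Inc e N.root) :
    ∃ S lam, N.RelMinMax X S lam ∧ e ∈ S ∧ N.Feasible (insert e X) ∧
      (∀ f ∈ S, N.Feasible (insert f X) → f = e) ∧ T = (N.contract (N.rooted X)).rooted S := by
  obtain ⟨S, lam, rfl, hne, hS, hrel⟩ := h.exists_relMinMax hN hcov hX htot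
  rw [inc_rooted_iff] at he
  obtain ⟨heS, her⟩ := he
  refine ⟨S, lam, hrel, heS, ?_, ?_, rfl⟩
  · exact (feasible_insert_iff hX (Set.disjoint_left.1 hrel.disjoint heS)).2
      (feasible_singleton hS.feasible heS her)
  · intro f hf hfX
    rw [feasible_insert_iff hX (Set.disjoint_left.1 hrel.disjoint hf)] at hfX
    exact hS.eq_of_inc_root prize_root_contract hf heS (inc_root_of_feasible_singleton hfX) her

theorem TreeGreedyRun.feasible (hN : N.Regular) (hcov : N.Coverable) (h : N.TreeGreedyRun π) :
    N.Feasible {f | f ∈ π} ∧ π.Nodup := by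
  induction h with
  | start => exact ⟨by simpa using Feasible.empty, List.nodup_nil⟩
  | step π T e _ htot hT he _ ih =>
    obtain ⟨S, lam, hrel, heS, hfe, -, -⟩ := RelMinMax.step hN hcov ih.1 htot hT he
    rw [setOf_mem_append_singleton]
    refine ⟨hfe, ?_⟩
    rw [List.nodup_append]
    refine ⟨ih.2, by simp, ?_⟩
    rintro a ha b hb rfl
    rw [List.mem_singleton] at hb
    subst hb
    exact Set.disjoint_left.1 hrel.disjoint heS ha

theorem TreeGreedyRun.exists_step (hN : N.Regular) (hcov : N.Coverable)
    (h : N.TreeGreedyRun π) (i : ℕ) (hi : i < π.length) :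
    ∃ S lam, N.RelMinMax {f | f ∈ π.take i} S lam ∧ π[i] ∈ S ∧
      ∀ f ∈ S, N.Feasible (insert f {f | f ∈ π.take i}) → f = π[i] := by
  induction h with
  | start => simp at hi
  | step π T e hπ htot hT he _ ih =>
    by_cases hi' : i < π.length
    · rw [List.take_append_of_le_length hi'.le, List.getElem_append_left hi']
      exact ih hi'
    · have hi'' : i = π.length := by
        rw [List.length_append, List.length_singleton] at hi
        omega
      subst hi''
      obtain ⟨S, lam, hrel, heS, -, huniq, -⟩ :=
        RelMinMax.step hN hcov (hπ.feasible hN hcov).1 htot hT he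
      refine ⟨S, lam, ?_⟩
      simpa using ⟨hrel, heS, huniq⟩

/-- A run that has not ended can be extended by one edge; as no edge repeats, lengths beyond the
number of edges are impossible, which forces an output. -/
theorem TreeGreedyRun.exists_output_or_length (hN : N.Regular) (hcov : N.Coverable) (n : ℕ) :
    (∃ π, N.TreeGreedyOutput π) ∨ ∃ π, N.TreeGreedyRun π ∧ π.length = n := by
  induction n with
  | zero => exact Or.inr ⟨[], .start, rfl⟩
  | succ n ih =>
    obtain h | ⟨π, hπ, hlen⟩ := ih
    · exact Or.inl h
    · by_cases htot : (N.contract (N.rooted {f | f ∈ π})).totalPrize = 0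
      · exact Or.inl ⟨π, hπ, htot⟩
      · have hX := (hπ.feasible hN hcov).1
        obtain ⟨T, hT⟩ := exists_isMinMax (hN.contract hX.subset).root_mem
        obtain ⟨S, lam, rfl, hne, hS, hrel⟩ := hT.exists_relMinMax hN hcov hX htot
        obtain ⟨e, he, her⟩ := hS.feasible.exists_inc_root hne
        refine Or.inr ⟨π ++ [e], .step π _ e hπ htot hT (inc_rooted_iff.2 ⟨he, her⟩) ?_, ?_⟩
        · intro f hf
          rw [inc_rooted_iff] at hf
          exact hS.eq_of_inc_root prize_root_contract hf.1 he hf.2 her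
        · simp [hlen]

theorem exists_treeGreedyOutput (hN : N.Regular) (hcov : N.Coverable) :
    ∃ π, N.TreeGreedyOutput π := by
  obtain h | ⟨π, hπ, hlen⟩ :=
    TreeGreedyRun.exists_output_or_length hN hcov (Nat.card E + 1)
  · exact h
  · have := Fintype.ofFinite E
    have := (hπ.feasible hN hcov).2.length_le_card
    rw [hlen, Nat.card_eq_fintype_card] at this
    omega

/-- As long as a min-max subtree has not been exhausted, the next min-max subtree is contained
in it. -/
theorem RelMinMax.subset_of_ssubset (hN : N.Regular) (hZ : N.Feasible Z)
    (hmax : ∀ Y, N.Feasible Y → Y ⊆ Z) (h : N.RelMinMax X S lam)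
    (h' : N.RelMinMax X' S' lam') (hX : X ⊂ X') (hX' : X' ⊂ X ∪ S) : S' ⊆ X ∪ S := by
  have hYf := h'.feasible
  have hWf := h.feasible
  set Y := X' ∪ S' with hY
  set W := X ∪ S with hW
  have hYZ := hmax Y hYf
  have hWZ := hmax W hWf
  have hUf := hYf.union hWf hZ hYZ hWZ
  have hIf := (hYf.inter hWf hZ hYZ hWZ).1
  have hXW : X ⊆ W := Set.subset_union_left
  have hp := hYf.setPrize_union_inter hWf hZ hYZ hWZ
  have hc := setCost_union_inter (N := N) (X := Y) (Y := W)
  have h1 := h'.le _ hIf (Set.subset_inter Set.subset_union_left hX'.1)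
  have h2 := h'.eq
  have h3 := h'.le W hWf hX'.1
  have h4 := h.lt X' h'.base hX hX'
  have h5 := h.eq
  have h6 := h.le _ hUf (hXW.trans Set.subset_union_right)
  have h7 := hN.setCost_lt hWf.subset hX'
  rw [← hY] at h2
  rw [← hW] at h5
  -- Over `X` the set `W` has density `lam` but its part `X'` has less, so the rest of `W` has
  -- marginal density above `lam` over `X'`, and at most `lam'`.
  have hlam : lam < lam' := by
    have : lam * (N.setCost W - N.setCost X') < lam' * (N.setCost W - N.setCost X') := by
      linarith
    exact lt_of_mul_lt_mul_right this (by linarith)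
  by_contra hS'
  have hss : W ⊂ Y ∪ W := by
    refine ⟨Set.subset_union_right, fun hsub => hS' ?_⟩
    exact Set.subset_union_right.trans (Set.subset_union_left.trans hsub)
  have h8 := hN.setCost_lt hUf.subset hss
  have h9 : lam * (N.setCost (Y ∪ W) - N.setCost W) < lam' * (N.setCost (Y ∪ W) - N.setCost W) :=
    mul_lt_mul_of_pos_right hlam (by linarith)
  -- The part of `Y` inside `W` has marginal density at most `lam'` over `X'`, so by modularity the
  -- part outside has at least `lam'` over `W`. Since `lam < lam'`, adding it to `W` would beat the
  -- maximal density `lam` over `X`.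
  have h10 : lam' * (N.setCost (Y ∪ W) - N.setCost W) =
      lam' * (N.setCost Y - N.setCost X') - lam' * (N.setCost (Y ∩ W) - N.setCost X') := by
    rw [← mul_sub]
    congr 1
    linarith
  linarith

/-- Since `X` has density at most `d`, the remainder of `Z` has marginal density at least `d` over
`X`, and at most `lam`. -/
theorem RelMinMax.le_density (hN : N.Regular) (hZ : N.Feasible Z)
    (hmax : ∀ Y, N.Feasible Y → Y ⊆ Z) (hd : N.setPrize Z = d * N.setCost Z)
    (hle : ∀ Y, N.Feasible Y → N.setPrize Y ≤ d * N.setCost Y)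
    (h : N.RelMinMax X S lam) (he : e ∈ S) : d ≤ lam := by
  have hXZ : X ⊂ Z := by
    refine ⟨hmax X h.base, fun hZX => ?_⟩
    exact Set.disjoint_left.1 h.disjoint he (hZX (hmax _ h.feasible (Or.inr he)))
  have h1 := hN.setCost_lt hZ.subset hXZ
  have h2 := h.le Z hZ hXZ.1
  have h3 := hle X h.base
  have : d * (N.setCost Z - N.setCost X) ≤ lam * (N.setCost Z - N.setCost X) := by
    linarith
  exact le_of_mul_le_mul_right this (by linarith)

/-- Between two states of the algorithm for trees, only the edges whose min-max subtree contains
the next edge are not paid for. -/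
theorem exists_unpaid_edges (hN : N.Regular) (hZ : N.Feasible Z)
    (hmax : ∀ Y, N.Feasible Y → Y ⊆ Z) (hd : N.setPrize Z = d * N.setCost Z)
    (hle : ∀ Y, N.Feasible Y → N.setPrize Y ≤ d * N.setCost Y)
    {k : ℕ} {X S : ℕ → Set E} {e : ℕ → E} {lam : ℕ → ℝ}
    (hX : ∀ i < k, X (i + 1) = insert (e i) (X i))
    (hrel : ∀ i ≤ k, N.RelMinMax (X i) (S i) (lam i)) (heS : ∀ i ≤ k, e i ∈ S i) (n a : ℕ)
    (ha : a + n = k) :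
    ∃ Q : Set E, (∀ f ∈ Q, ∃ i, a ≤ i ∧ i < k ∧ f = e i ∧ e k ∈ S i) ∧
      d * (N.setCost (X k) - N.setCost (X a) - N.setCost Q) ≤
        N.setPrize (X k) - N.setPrize (X a) := by
  have hmono : ∀ i j, i ≤ j → j ≤ k → X i ⊆ X j := by
    intro i j hij
    induction j, hij using Nat.le_induction with
    | base => exact fun _ => subset_rfl
    | succ j hij ih =>
      intro hj
      rw [hX j (by omega)]
      exact (ih (by omega)).trans (Set.subset_insert _ _)
  have hnot : ∀ i ≤ k, e i ∉ X i := fun i hi =>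
    Set.disjoint_left.1 (hrel i hi).disjoint (heS i hi)
  induction n using Nat.strong_induction_on generalizing a with
  | _ n ih =>
    obtain rfl | hn := n.eq_zero_or_pos
    · obtain rfl : a = k := by omega
      refine ⟨∅, by simp, ?_⟩
      simp [setCost_empty]
    -- If `e k ∈ S a`, the edge `e a` is declared unpaid and only `0 ≤` its marginal prize is used;
    -- otherwise the run jumps to the end of `X a ∪ S a`.
    by_cases hea : e k ∈ S a
    · obtain ⟨Q, hQ, hle'⟩ := ih (n - 1) (by omega) (a + 1) (by omega)
      refine ⟨insert (e a) Q, ?_, ?_⟩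
      · rintro f (rfl | hf)
        · exact ⟨a, le_rfl, by omega, rfl, hea⟩
        · obtain ⟨i, h1, h2⟩ := hQ f hf
          exact ⟨i, by omega, h2⟩
      · have heQ : e a ∉ Q := by
          intro heQ
          obtain ⟨i, h1, h2, h3, -⟩ := hQ _ heQ
          refine hnot i h2.le (h3 ▸ hmono (a + 1) i h1 h2.le ?_)
          rw [hX a (by omega)]
          exact Set.mem_insert _ _
        have h1 := hN.setPrize_mono (hmono a (a + 1) (by omega) (by omega))
        rw [hX a (by omega)] at h1 hle'
        rw [setCost_insert (hnot a (by omega))] at hle'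
        rw [setCost_insert heQ]
        have h2 : N.setCost (X k) - N.setCost (X a) - (N.cost (e a) + N.setCost Q) =
          N.setCost (X k) - (N.cost (e a) + N.setCost (X a)) - N.setCost Q := by ring
        rw [h2]
        linarith
    -- If the run never hit `X a ∪ S a` exactly, nesting would keep all states up to `k` strictly
    -- inside it, and then `e k ∈ S k` would be in `S a` too.
    · obtain ⟨b, hab, hbk, hb⟩ : ∃ b, a < b ∧ b ≤ k ∧ X b = X a ∪ S a := by
        by_contra! hne
        have hsub : ∀ j, a + 1 ≤ j → j ≤ k → X j ⊂ X a ∪ S a := by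
          intro j hj
          induction j, hj using Nat.le_induction with
          | base =>
            intro hk
            refine LE.le.ssubset_of_ne ?_ (hne _ (by omega) hk)
            rw [hX a (by omega)]
            exact Set.insert_subset (Or.inr (heS a (by omega))) Set.subset_union_left
          | succ j hj ihj =>
            intro hk
            refine LE.le.ssubset_of_ne ?_ (hne _ (by omega) hk)
            have hj' := ihj (by omega)
            have hss : X a ⊂ X j := by
              refine ⟨hmono a j (by omega) (by omega), fun h => hnot a (by omega) (h ?_)⟩
              refine hmono (a + 1) j hj (by omega) ?_
              rw [hX a (by omega)]
              exact Set.mem_insert _ _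
            rw [hX j (by omega)]
            refine Set.insert_subset ?_ hj'.1
            exact (hrel a (by omega)).subset_of_ssubset hN hZ hmax (hrel j (by omega)) hss hj'
              (heS j (by omega))
        have hk := hsub k (by omega) le_rfl
        have hss : X a ⊂ X k := by
          refine ⟨hmono a k (by omega) (by omega), fun h => hnot a (by omega) (h ?_)⟩
          refine hmono (a + 1) k (by omega) (by omega) ?_
          rw [hX a (by omega)]
          exact Set.mem_insert _ _
        have := (hrel a (by omega)).subset_of_ssubset hN hZ hmax (hrel k le_rfl) hss hk
          (heS k le_rfl)
        obtain h | h := this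
        · exact hnot k le_rfl (hss.1 h)
        · exact hea h
      obtain ⟨Q, hQ, hle'⟩ := ih (k - b) (by omega) b (by omega)
      refine ⟨Q, ?_, ?_⟩
      · intro f hf
        obtain ⟨i, h1, h2⟩ := hQ f hf
        exact ⟨i, by omega, h2⟩
      · have h1 := (hrel a (by omega)).eq
        rw [← hb] at h1
        -- The completed stretch from `a` to `b` is paid at density `lam a ≥ d`.
        have h2 := (hrel a (by omega)).le_density hN hZ hmax hd hle (heS a (by omega))
        have h3 := hN.setCost_mono ((hrel b hbk).base).subset (hmono a b hab.le hbk)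
        have h4 := mul_le_mul_of_nonneg_right h2 (sub_nonneg.2 h3)
        have h5 : d * (N.setCost (X k) - N.setCost (X a) - N.setCost Q) =
          d * (N.setCost (X k) - N.setCost (X b) - N.setCost Q) +
            d * (N.setCost (X b) - N.setCost (X a)) := by ring
        linarith

/-- The prize of a prefix of a run of the algorithm for trees: up to the cost of some edges that
belong to every rooted subtree that contains the next edge, the prefix together with the next edge
has at least the density of the whole tree. -/
theorem TreeGreedyRun.prize_take (hN : N.Regular) (hcov : N.Coverable) (hZ : N.Feasible Z)
    (hmax : ∀ Y, N.Feasible Y → Y ⊆ Z) (hroot : N.prize N.root = 0)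
    (hd : N.setPrize Z = d * N.setCost Z)
    (hle : ∀ Y, N.Feasible Y → N.setPrize Y ≤ d * N.setCost Y) (h : N.TreeGreedyRun π) (k : ℕ)
    (hk : k < π.length) :
    ∃ Q, (∀ R, N.Feasible R → π[k] ∈ R → Q ⊆ R) ∧
      d * (N.setCost {f | f ∈ π.take k} + N.cost π[k] - N.setCost Q) ≤
        N.setPrize {f | f ∈ π.take k} := by
  have hstep : ∀ i, ∃ e S lam, i ≤ k → π[i]? = some e ∧ N.RelMinMax {f | f ∈ π.take i} S lam ∧
      e ∈ S ∧ ∀ f ∈ S, N.Feasible (insert f {f | f ∈ π.take i}) → f = e := by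
    intro i
    by_cases hi : i ≤ k
    · obtain ⟨S, lam, h1, h2, h3⟩ := h.exists_step hN hcov i (by omega)
      exact ⟨π[i], S, lam, fun _ => ⟨List.getElem?_eq_getElem (by omega), h1, h2, h3⟩⟩
    -- Arbitrary values past `k`, so that `choose` yields functions on all of ℕ.
    · exact ⟨π[k], ∅, 0, fun h => absurd h hi⟩
  choose e S lam hall using hstep
  have hek : e k = π[k] := by
    have := (hall k le_rfl).1
    rw [List.getElem?_eq_getElem hk] at this
    exact (Option.some.inj this).symm
  have hnot : ∀ i ≤ k, e i ∉ {f | f ∈ π.take i} := fun i hi =>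
    Set.disjoint_left.1 (hall i hi).2.1.disjoint (hall i hi).2.2.1
  have hmono : ∀ i ≤ k, {f | f ∈ π.take i} ⊆ {f | f ∈ π.take k} := fun i hi f hf =>
    (List.take_subset_take_left π hi) hf
  have hX : ∀ i < k, {f | f ∈ π.take (i + 1)} = insert (e i) {f | f ∈ π.take i} := by
    intro i hi
    rw [List.take_add_one, (hall i hi.le).1, Option.toList_some, setOf_mem_append_singleton]
  obtain ⟨Q, hQ, hprize⟩ := exists_unpaid_edges hN hZ hmax hd hle
    (X := fun i => {f | f ∈ π.take i}) hX (fun i hi => (hall i hi).2.1)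
    (fun i hi => (hall i hi).2.2.1) k 0 (by omega)
  have hempty : {f | f ∈ π.take 0} = ∅ := by simp
  rw [hempty, setPrize_empty, hroot, setCost_empty, sub_zero, sub_zero] at hprize
  have heQ : e k ∉ Q := by
    intro heQ
    obtain ⟨i, -, h2, h3, -⟩ := hQ _ heQ
    refine hnot k le_rfl ?_
    rw [h3]
    have : e i ∈ {f | f ∈ π.take (i + 1)} := by
      rw [hX i h2]
      exact Set.mem_insert _ _
    exact hmono (i + 1) h2 this
  -- Adding `e k` to the unpaid edges cancels its cost, which the estimate counts before its prize
  -- is collected.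
  refine ⟨insert (e k) Q, ?_, ?_⟩
  · intro R hR hekR
    rw [← hek] at hekR
    refine Set.insert_subset hekR fun f hf => ?_
    obtain ⟨i, -, hik, rfl, hi⟩ := hQ f hf
    obtain ⟨-, hrel, -, huniq⟩ := hall i hik.le
    -- The sets `X i ∪ R` and `X i ∪ S i` both contain `e k`, so their intersection properly extends
    -- `X i`. Its first pendant edge lies in `S i`, so it equals `e i` by uniqueness, and it lies in
    -- `R`.
    have hUf := hrel.base.union hR hZ (hmax _ hrel.base) (hmax _ hR)
    have hIf := (hUf.inter hrel.feasible hZ (hmax _ hUf) (hmax _ hrel.feasible)).1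
    have hss : {f | f ∈ π.take i} ⊂ ({f | f ∈ π.take i} ∪ R) ∩ ({f | f ∈ π.take i} ∪ S i) := by
      refine ⟨Set.subset_inter Set.subset_union_left Set.subset_union_left, fun hsub => ?_⟩
      exact hnot k le_rfl (hmono i hik.le (hsub ⟨Or.inr hekR, Or.inr hi⟩))
    obtain ⟨g, hg, hgX, x, hx, y, hy, hl⟩ := hrel.base.exists_insert hIf hss
    have hgR := hg.1.resolve_left hgX
    rwa [huniq g (hg.2.resolve_left hgX) (hrel.base.insert hl hx hy)] at hgR
  · rw [setCost_insert heQ, hek]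
    refine le_trans (le_of_eq ?_) hprize
    ring

end Network

/-! ### The algorithm for general graphs and its competitive ratio -/

namespace Network

variable {V E : Type} {N : Network V E} {F O X Y Z S S' X' : Set E} {e f : E} {x y v : V}
  {T T' : Graph V E} [Finite V] [Finite E] {lam lam' d : ℝ} {π ρ : List E}

theorem listCost_append : N.listCost (π ++ ρ) = N.listCost π + N.listCost ρ := by
  simp [listCost]

theorem setCost_setOf_mem (h : π.Nodup) : N.setCost {f | f ∈ π} = N.listCost π := by
  induction π with
  | nil => simp [setCost_empty, listCost]
  | cons a π ih =>
    obtain ⟨ha, h⟩ := List.nodup_cons.1 h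
    have : {f | f ∈ a :: π} = insert a {f | f ∈ π} := by
      ext f
      simp
    rw [this, setCost_insert (show a ∉ {f | f ∈ π} from ha), ih h]
    simp [listCost]

theorem setOf_mem_append : {f | f ∈ π ++ ρ} = {f | f ∈ π} ∪ {f | f ∈ ρ} := by
  ext f
  simp

theorem finite_setOf_isPath (G : Graph V E) (u : V) :
    {w | ∃ v, IsPath G u w v}.Finite := by
  refine (List.finite_length_le (E × V) (Nat.card V)).subset ?_
  rintro w ⟨v, -, hn⟩
  have := Fintype.ofFinite V
  have h := (List.nodup_cons.1 hn).2.length_le_card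
  rw [List.length_map] at h
  rwa [← Nat.card_eq_fintype_card] at h

theorem listCost_le_gamma {w : List (E × V)} (h : IsPath N.graph N.root w v) :
    N.listCost (w.map Prod.fst) ≤ N.gamma := by
  refine le_csSup (Set.Finite.bddAbove ?_) ⟨w, v, h, rfl⟩
  refine ((finite_setOf_isPath N.graph N.root).image
    fun w => N.listCost (w.map Prod.fst)).subset ?_
  rintro _ ⟨w, v, h, rfl⟩
  exact ⟨w, ⟨v, h⟩, rfl⟩

/-- Every edge of a rooted subtree lies on a path of that subtree that starts in the root. -/
theorem Feasible.exists_subset_cost_le_gamma (hr : N.root ∈ V(N.graph)) (h : N.Feasible F)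
    (he : e ∈ F) : ∃ R ⊆ F, N.Feasible R ∧ e ∈ R ∧ N.setCost R ≤ N.gamma := by
  induction h with
  | empty => exact absurd he (Set.notMem_empty _)
  | @insert F f x y hF hl hx hy ih =>
    obtain rfl | he := he
    · have hy' : y ∈ V(N.rooted (Insert.insert e F)) :=
        mem_rooted_of_inc (Set.mem_insert _ _) hl.inc_right
      obtain ⟨w, hp, hw, hwF, hyw, -⟩ := (hF.insert hl hx hy).exists_isPath hr hy'
      refine ⟨_, hwF, hw, ?_, ?_⟩
      · obtain rfl | ⟨g, hg, hgy⟩ := hyw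
        · exact absurd root_mem_rooted hy
        · obtain rfl | hgF := hwF hg
          · exact hg
          · exact absurd (mem_rooted_of_inc hgF hgy) hy
      · rw [setCost_setOf_mem hp.nodup_edges]
        exact listCost_le_gamma hp
    · obtain ⟨R, hR, h⟩ := ih he
      exact ⟨R, hR.trans (Set.subset_insert _ _), h⟩

theorem feasible_restrictTo_contract_iff (hF : N.Feasible F) :
    ((N.contract (N.rooted F)).restrictTo ((N.contract (N.rooted F)).rooted S)).Feasible Y ↔
      (Disjoint Y F ∧ N.Feasible (F ∪ Y)) ∧ Y ⊆ S := by
  rw [feasible_restrictTo_iff, feasible_contract_iff hF]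

theorem setPrize_restrictTo_contract (hF : N.Feasible F) (hY : Y ⊆ S) (hd : Disjoint Y F) :
    ((N.contract (N.rooted F)).restrictTo ((N.contract (N.rooted F)).rooted S)).setPrize Y =
      N.setPrize (F ∪ Y) - N.setPrize F := by
  rw [setPrize_restrictTo hY, setPrize_contract hF.subset hd]

/-- The effect of one step of the algorithm for general graphs. -/
theorem RelMinMax.greedy_step (hN : N.Regular) (hcov : N.Coverable) (hF : N.Feasible F)
    (htot : (N.contract (N.rooted F)).totalPrize ≠ 0)
    (hT : (N.contract (N.rooted F)).IsMinMax T)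
    (hρ : ((N.contract (N.rooted F)).restrictTo
      (N.contractSub (N.extension T) (N.rooted F))).TreeGreedyOutput ρ) :
    ∃ S lam, N.RelMinMax F S lam ∧ S.Nonempty ∧ E(N.extension T) = S ∧ {f | f ∈ ρ} = S ∧
      ρ.Nodup ∧ (∀ i ≤ ρ.length, N.Feasible (F ∪ {f | f ∈ ρ.take i})) ∧
      ∀ k (hk : k < ρ.length),
        lam * (N.setCost {f | f ∈ ρ.take k} + N.cost ρ[k] - N.gamma) ≤
          N.setPrize (F ∪ {f | f ∈ ρ.take k}) - N.setPrize F := by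
  obtain ⟨S, lam, rfl, hne, hS, hrel⟩ := hT.exists_relMinMax hN hcov hF htot
  rw [contractSub_extension hF.subset hS.feasible hne] at hρ
  have hM := hN.contract hF.subset
  set M := N.contract (N.rooted F) with hMdef
  have hK : (M.restrictTo (M.rooted S)).Regular := hM.restrictTo
  have hKcov : (M.restrictTo (M.rooted S)).Coverable := Coverable.restrictTo hS.feasible
  have hKfeas : ∀ Y, (M.restrictTo (M.rooted S)).Feasible Y ↔
      (Disjoint Y F ∧ N.Feasible (F ∪ Y)) ∧ Y ⊆ S := fun Y => feasible_restrictTo_contract_iff hF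
  have hKprize : ∀ Y ⊆ S, (M.restrictTo (M.rooted S)).setPrize Y =
      N.setPrize (F ∪ Y) - N.setPrize F := fun Y hY =>
    setPrize_restrictTo_contract hF hY (hrel.disjoint.mono_left hY)
  obtain ⟨hrun, hzero⟩ := hρ
  obtain ⟨hρf, hnd⟩ := hrun.feasible hK hKcov
  have hρS := ((hKfeas _).1 hρf).2
  have hKS : (M.restrictTo (M.rooted S)).Feasible S :=
    feasible_restrictTo_iff.2 ⟨hS.feasible, subset_rfl⟩
  have hKmax : ∀ Y, (M.restrictTo (M.rooted S)).Feasible Y → Y ⊆ S :=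
    fun Y hY => ((hKfeas Y).1 hY).2
  have hKd : (M.restrictTo (M.rooted S)).setPrize S =
      lam * (M.restrictTo (M.rooted S)).setCost S := by
    rw [setPrize_restrictTo subset_rfl, hS.eq]
    rfl
  have hKle : ∀ Y, (M.restrictTo (M.rooted S)).Feasible Y →
      (M.restrictTo (M.rooted S)).setPrize Y ≤ lam * (M.restrictTo (M.rooted S)).setCost Y := by
    intro Y hY
    rw [setPrize_restrictTo (hKmax Y hY)]
    exact hS.le Y (feasible_restrictTo_iff.1 hY).1
  -- The inner run stops with the full prize `lam * c(S)` collected; a proper subset would achieve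
  -- this at lower cost, hence at a density above `lam`.
  have hall : {f | f ∈ ρ} = S := by
    by_contra hne'
    have hlt := hK.setCost_lt hKS.subset (hρS.ssubset_of_ne hne')
    rw [totalPrize_contract hK.root_mem, totalPrize_restrictTo, sub_eq_zero, hS.eq] at hzero
    have h1 := hKle _ hρf
    rw [← hzero] at h1
    exact absurd (le_of_mul_le_mul_left h1 hS.pos) (not_le.2 hlt)
  have htake : ∀ i ≤ ρ.length, (M.restrictTo (M.rooted S)).Feasible {f | f ∈ ρ.take i} := by
    intro i hi
    obtain rfl | hi := hi.eq_or_lt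
    · rwa [List.take_length]
    · obtain ⟨_, _, h, -⟩ := hrun.exists_step hK hKcov i hi
      exact h.base
  refine ⟨S, lam, hrel, hne, edgeSet_extension hF.subset hS.feasible, hall, hnd,
    fun i hi => ((hKfeas _).1 (htake i hi)).1.2, fun k hk => ?_⟩
  obtain ⟨Q, hQ, hle⟩ := hrun.prize_take hK hKcov hKS hKmax (show M.prize M.root = 0 from if_pos rfl)
    hKd hKle k hk
  have hkf := (hKfeas _).1 (htake (k + 1) hk)
  have hkS := ((hKfeas _).1 (htake k hk.le)).2
  have hmem : ρ[k] ∈ {f | f ∈ ρ.take (k + 1)} := by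
    change ρ[k] ∈ ρ.take (k + 1)
    rw [List.take_add_one, List.getElem?_eq_getElem hk]
    exact List.mem_append_right _ (List.mem_singleton_self _)
  have hkF : ρ[k] ∉ F := Set.disjoint_left.1 hkf.1.1 hmem
  -- A path from the true root to `ρ[k]` may run through `F`. Its edges outside `F` form a rooted
  -- subtree of the contracted network and contain `Q`, so `Q` costs at most γ.
  obtain ⟨R, hRsub, hR, hkR, hRγ⟩ := hkf.1.2.exists_subset_cost_le_gamma hN.root_mem
    (Set.mem_union_right F hmem)
  have hRS : F ∪ R ⊆ F ∪ S :=
    Set.union_subset Set.subset_union_left (hRsub.trans (Set.union_subset_union_right _ hkf.2))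
  have hUf := hF.union hR hrel.feasible Set.subset_union_left
    (Set.subset_union_right.trans hRS)
  have hRK : (M.restrictTo (M.rooted S)).Feasible (R \ F) := by
    rw [hKfeas]
    refine ⟨⟨disjoint_sdiff_self_left, by rwa [Set.union_sdiff_self]⟩, fun f hf => ?_⟩
    exact (hRS (Or.inr hf.1)).resolve_left hf.2
  have hQR : Q ⊆ R := (hQ _ hRK ⟨hkR, hkF⟩).trans Set.sdiff_subset
  have hQc := (hN.setCost_mono hR.subset hQR).trans hRγ
  rw [hKprize _ hkS] at hle
  refine le_trans (mul_le_mul_of_nonneg_left ?_ hrel.pos.le) hle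
  exact sub_le_sub_left hQc _

/-- Extending `F` by edges of `O` until the vertices of `O` are covered adds cost at most `c(O)`, at
marginal density at most `lam`. -/
theorem RelMinMax.prize_le (hN : N.Regular) (h : N.RelMinMax F S lam) (hO : N.Feasible O) :
    N.setPrize O ≤ N.setPrize F + lam * N.setCost O := by
  obtain ⟨X, hXO, hX, hverts⟩ := h.base.exists_extension hO
  have h1 := hN.setPrize_mono_verts hverts
  have h2 := h.le _ hX Set.subset_union_left
  rw [← setCost_sdiff Set.subset_union_left] at h2
  have h3 : N.setCost ((F ∪ X) \ F) ≤ N.setCost O := by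
    refine hN.setCost_mono hO.subset ?_
    rw [Set.union_sdiff_left]
    exact Set.sdiff_subset.trans hXO
  have h4 := mul_le_mul_of_nonneg_left h3 h.pos.le
  linarith

/-- The density of min-max subtrees does not increase when they are contracted. -/
theorem RelMinMax.density_antitone (hN : N.Regular) (h : N.RelMinMax F S lam)
    (h' : N.RelMinMax (F ∪ S) S' lam') (hne : S'.Nonempty) : lam' ≤ lam := by
  have h1 := h.le _ h'.feasible (Set.subset_union_left.trans Set.subset_union_left)
  have h2 := h'.eq
  have h3 := h.eq
  have h4 : N.setCost (F ∪ S) < N.setCost (F ∪ S ∪ S') := by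
    refine hN.setCost_lt h'.feasible.subset ⟨Set.subset_union_left, fun hsub => ?_⟩
    obtain ⟨e, he⟩ := hne
    exact Set.disjoint_left.1 h'.disjoint he (hsub (Or.inr he))
  have : lam' * (N.setCost (F ∪ S ∪ S') - N.setCost (F ∪ S)) ≤
      lam * (N.setCost (F ∪ S ∪ S') - N.setCost (F ∪ S)) := by
    linarith
  exact le_of_mul_le_mul_right this (by linarith)

/-- What is maintained by the algorithm for general graphs. -/
structure GreedyInvariant (N : Network V E) (π : List E) (F : Set E) : Prop where
  eq : {f | f ∈ π} = F
  nodup : π.Nodup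
  feasible : ∀ i ≤ π.length, N.Feasible {f | f ∈ π.take i}
  density_le : ∀ S lam, N.RelMinMax F S lam → S.Nonempty → lam * N.setCost F ≤ N.setPrize F
  prize : ∀ k < π.length, ∃ d, 0 ≤ d ∧
    d * (N.listCost (π.take (k + 1)) - N.gamma) ≤ N.setPrize {f | f ∈ π.take k} ∧
    ∀ O, N.Feasible O → N.setPrize O ≤ N.setPrize {f | f ∈ π.take k} + d * N.setCost O

theorem GreedyInvariant.base (h : N.GreedyInvariant π F) : N.Feasible F := by
  have := h.feasible _ le_rfl
  rwa [List.take_length, h.eq] at this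

/-- For an edge of the new phase the witness `d` is its density `lam`: `density_le` pays for all of
`F` at this rate, and `greedy_step` pays for the started phase up to γ. Antitone densities carry
`density_le` on to later phases. -/
theorem GreedyInvariant.step (hN : N.Regular) (hcov : N.Coverable) (h : N.GreedyInvariant π F)
    (htot : (N.contract (N.rooted F)).totalPrize ≠ 0)
    (hT : (N.contract (N.rooted F)).IsMinMax T)
    (hρ : ((N.contract (N.rooted F)).restrictTo
      (N.contractSub (N.extension T) (N.rooted F))).TreeGreedyOutput ρ) :
    N.GreedyInvariant (π ++ ρ) (F ∪ E(N.extension T)) := by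
  have hF := h.base
  obtain ⟨S, lam, hrel, hne, hext, hall, hnd, hfeas, hprize⟩ :=
    RelMinMax.greedy_step hN hcov hF htot hT hρ
  have hFle := h.density_le S lam hrel hne
  rw [hext]
  have htake : ∀ j, {f | f ∈ (π ++ ρ).take (π.length + j)} = F ∪ {f | f ∈ ρ.take j} := by
    intro j
    rw [List.take_length_add_append, setOf_mem_append, h.eq]
  refine ⟨by rw [setOf_mem_append, h.eq, hall], ?_, ?_, ?_, ?_⟩
  · rw [List.nodup_append]
    refine ⟨h.nodup, hnd, ?_⟩
    rintro a ha b hb rfl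
    have ha' : a ∈ F := h.eq ▸ ha
    have hb' : a ∈ S := hall ▸ hb
    exact Set.disjoint_left.1 hrel.disjoint hb' ha'
  · intro i hi
    by_cases hi' : i ≤ π.length
    · rw [List.take_append_of_le_length hi']
      exact h.feasible i hi'
    · obtain ⟨j, rfl⟩ := Nat.exists_eq_add_of_le (not_le.1 hi').le
      rw [htake]
      rw [List.length_append] at hi
      exact hfeas j (by omega)
  · intro S' lam' hrel' hne'
    have h1 := hrel.density_antitone hN hrel' hne'
    have h2 := hrel.eq
    have h3 := mul_le_mul_of_nonneg_right h1 (hN.setCost_nonneg hrel.feasible.subset)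
    have h4 : lam * (N.setCost (F ∪ S) - N.setCost F) =
      lam * N.setCost (F ∪ S) - lam * N.setCost F := by ring
    linarith
  · intro k hk
    by_cases hk' : k < π.length
    · rw [List.take_append_of_le_length hk'.le, List.take_append_of_le_length hk']
      exact h.prize k hk'
    · obtain ⟨j, rfl⟩ := Nat.exists_eq_add_of_le (not_lt.1 hk')
      rw [List.length_append] at hk
      have hj : j < ρ.length := by omega
      have hp := hprize j hj
      refine ⟨lam, hrel.pos.le, ?_, ?_⟩
      · have hc : N.listCost ((π ++ ρ).take (π.length + j + 1)) =
            N.setCost F + N.setCost {f | f ∈ ρ.take j} + N.cost ρ[j] := by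
          rw [add_assoc, List.take_length_add_append, listCost_append, ← setCost_setOf_mem h.nodup,
            h.eq, setCost_setOf_mem (hnd.sublist (List.take_sublist _ _)), List.take_add_one,
            List.getElem?_eq_getElem hj, listCost_append]
          simp [listCost, add_assoc]
        rw [htake, hc]
        have h4 : lam * (N.setCost F + N.setCost {f | f ∈ ρ.take j} + N.cost ρ[j] - N.gamma) =
          lam * N.setCost F + lam * (N.setCost {f | f ∈ ρ.take j} + N.cost ρ[j] - N.gamma) := by
          ring
        linarith
      · intro O hO
        rw [htake]
        have h1 := hrel.prize_le hN hO
        have h2 := hN.setPrize_mono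
          (Set.subset_union_left : F ⊆ F ∪ {f | f ∈ ρ.take j})
        linarith

theorem GreedyRun.invariant (hN : N.Regular) (hcov : N.Coverable) (h : N.GreedyRun π F) :
    N.GreedyInvariant π F := by
  induction h with
  | start =>
    refine ⟨by simp, List.nodup_nil, ?_, ?_, by simp⟩
    · intro i _
      simpa using Feasible.empty
    · intro S lam _ _
      rw [setCost_empty, mul_zero]
      exact hN.setPrize_nonneg
  | step π F T ρ _ htot hT hρ ih => exact ih.step hN hcov htot hT hρ

theorem GreedyRun.exists_output_or_length (hN : N.Regular) (hcov : N.Coverable) (n : ℕ) :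
    (∃ π, N.GreedyOutput π) ∨ ∃ π F, N.GreedyRun π F ∧ n ≤ π.length := by
  induction n with
  | zero => exact Or.inr ⟨[], ∅, .start, le_rfl⟩
  | succ n ih =>
    obtain h | ⟨π, F, hπ, hlen⟩ := ih
    · exact Or.inl h
    · by_cases htot : (N.contract (N.rooted F)).totalPrize = 0
      · exact Or.inl ⟨π, F, hπ, htot⟩
      · have hF := (hπ.invariant hN hcov).base
        obtain ⟨T, hT⟩ := exists_isMinMax (hN.contract hF.subset).root_mem
        obtain ⟨ρ, hρ⟩ : ∃ ρ, ((N.contract (N.rooted F)).restrictTo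
            (N.contractSub (N.extension T) (N.rooted F))).TreeGreedyOutput ρ := by
          obtain ⟨S, lam, rfl, hne, hS, hrel⟩ := hT.exists_relMinMax hN hcov hF htot
          rw [contractSub_extension hF.subset hS.feasible hne]
          exact exists_treeGreedyOutput (hN.contract hF.subset).restrictTo
            (Coverable.restrictTo hS.feasible)
        obtain ⟨S, lam, -, hne, -, hall, -⟩ := RelMinMax.greedy_step hN hcov hF htot hT hρ
        refine Or.inr ⟨π ++ ρ, _, .step π F T ρ hπ htot hT hρ, ?_⟩
        have : ρ ≠ [] := by
          rintro rfl
          rw [← hall] at hne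
          simp at hne
        have := List.length_pos_iff.2 this
        rw [List.length_append]
        omega

theorem exists_greedyOutput (hN : N.Regular) (hcov : N.Coverable) : ∃ π, N.GreedyOutput π := by
  obtain h | ⟨π, F, hπ, hlen⟩ := GreedyRun.exists_output_or_length hN hcov (Nat.card E + 1)
  · exact h
  · have := Fintype.ofFinite E
    have := (hπ.invariant hN hcov).nodup.length_le_card
    rw [← Nat.card_eq_fintype_card] at this
    omega

/-- A missed vertex of positive prize would leave positive total prize after the final contraction.
-/
theorem GreedyOutput.isIncrementalSolution (hN : N.Regular) (hcov : N.Coverable)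
    (h : N.GreedyOutput π) : N.IsIncrementalSolution π := by
  obtain ⟨F, hrun, hzero⟩ := h
  have hinv := hrun.invariant hN hcov
  refine ⟨hinv.nodup, ?_, fun j hj => (hinv.feasible j hj).isRootedSubtree hN.root_mem, ?_⟩
  · intro e he
    refine hinv.base.subset ?_
    rw [← hinv.eq]
    exact he
  · intro v hv hp
    rw [hinv.eq]
    by_contra hvF
    rw [totalPrize_contract hN.root_mem] at hzero
    have h1 := sum_sdiff_of_subset (g := N.prize) (rooted_le (F := F) hN.root_mem).vertexSet_mono
    have h2 : ∑ᶠ u ∈ ({v} : Set V), N.prize u ≤ ∑ᶠ v ∈ V(N.graph) \ V(N.rooted F), N.prize v :=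
      sum_le_sum_of_subset (Set.singleton_subset_iff.2 (Set.mem_sdiff_of_mem hv hvF))
        fun v hv => hN.prize_nonneg v hv.1
    rw [finsum_mem_singleton, h1] at h2
    have h3 : N.totalPrize - N.setPrize F =
      ∑ᶠ v ∈ V(N.graph), N.prize v - ∑ᶠ v ∈ V(N.rooted F), N.prize v := rfl
    linarith

/-- Either the whole sequence fits and collects the total prize, or the invariant is applied at the
first edge that exceeds the budget. -/
theorem GreedyOutput.competitive (hN : N.Regular) (hcov : N.Coverable) (h : N.GreedyOutput π)
    {B : ℝ} (hT : N.IsOpt B T) :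
    N.prizeOf T ≤ 2 * N.prizeOf (N.algTree π (B + N.gamma)) := by
  obtain ⟨F, hrun, hzero⟩ := h
  have hinv := hrun.invariant hN hcov
  obtain ⟨⟨hT, hB⟩, -⟩ := hT
  have hO := hT.feasible
  have hTO := hT.eq_rooted
  set O := E(T) with hOdef
  clear_value O
  subst hTO
  rw [costOf_rooted hO.subset] at hB
  change N.setPrize O ≤ 2 * N.setPrize
    {e | ∃ i, π[i]? = some e ∧ N.listCost (π.take (i + 1)) ≤ B + N.gamma}
  set A := {e | ∃ i, π[i]? = some e ∧ N.listCost (π.take (i + 1)) ≤ B + N.gamma} with hA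
  by_cases hall : ∀ k < π.length, N.listCost (π.take (k + 1)) ≤ B + N.gamma
  · have hFA : F ⊆ A := by
      rw [← hinv.eq]
      intro e he
      obtain ⟨i, hi, rfl⟩ := List.getElem_of_mem he
      exact ⟨i, List.getElem?_eq_getElem hi, hall i hi⟩
    have h1 := hN.setPrize_mono hFA
    rw [totalPrize_contract hN.root_mem, sub_eq_zero] at hzero
    have h2 := hN.setPrize_le_totalPrize (X := O)
    have h3 := hN.setPrize_nonneg (X := A)
    linarith
  · push Not at hall
    classical
    obtain ⟨hk, hkB⟩ := Nat.find_spec hall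
    set k := Nat.find hall with hkdef
    have hkA : {f | f ∈ π.take k} ⊆ A := by
      intro e he
      obtain ⟨i, hi, rfl⟩ := List.getElem_of_mem he
      rw [List.length_take] at hi
      have hik : i < k := by omega
      have := Nat.find_min hall hik
      refine ⟨i, by rw [List.getElem_take, List.getElem?_eq_getElem], ?_⟩
      by_contra hlt
      exact this ⟨by omega, not_le.1 hlt⟩
    have h1 := hN.setPrize_mono hkA
    obtain ⟨d, hd, h2, h3⟩ := hinv.prize k hk
    have h4 := h3 O hO
    -- Overshooting means `B < c(prefix with edge k) - γ`, so the additional prize of `O` is bounded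
    -- by the prize of the prefix.
    have h5 : d * N.setCost O ≤ d * (N.listCost (π.take (k + 1)) - N.gamma) :=
      mul_le_mul_of_nonneg_left (by linarith) hd
    linarith

end Network

/-! ### Application to instances -/

theorem Instance.regular (I : Instance) : I.net.Regular :=
  ⟨I.root_mem, I.cost_pos, I.prize_nonneg⟩

/-- A maximal feasible set has no leaving edge, so it covers everything reachable from the root. -/
theorem Instance.coverable (I : Instance) : I.net.Coverable := by
  have := I.finite_E
  obtain ⟨X, -, -, hX, hmax⟩ := Network.Feasible.empty.exists_maximal (N := I.net)
    (Set.empty_subset Set.univ)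
  refine ⟨X, hX, fun v hv hp => ?_⟩
  by_contra hvX
  obtain ⟨w, hw⟩ := I.reachable v hv hp
  obtain ⟨e, x, hx, y, hy, hl⟩ := hw.exists_link_leaving Network.root_mem_rooted hvX
  exact hmax e (Set.mem_univ _) x hx y hy hl

theorem exists_isDensityGreedy : ∃ A : Algorithm, IsDensityGreedy A := by
  have h : ∀ I : Instance, ∃ π, I.net.GreedyOutput π := fun I =>
    have := I.finite_V
    have := I.finite_E
    Network.exists_greedyOutput I.regular I.coverable
  choose A hA using h
  exact ⟨A, hA⟩

theorem IsDensityGreedy.isCompetitiveOn {A : Algorithm} (hA : IsDensityGreedy A) :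
    IsCompetitiveOn Set.univ A (fun I => I.net.gamma) 2 := by
  intro I _
  have := I.finite_V
  have := I.finite_E
  exact ⟨(hA I).isIncrementalSolution I.regular I.coverable,
    fun B _ T hT => (hA I).competitive I.regular I.coverable hT⟩

/-! ### The first phase of a run, for the lower bound -/

namespace Network

variable {V E : Type} {N : Network V E} {F O X Y Z S S' X' : Set E} {e f : E} {x y v : V}
  {T T' : Graph V E} [Finite V] [Finite E] {lam lam' d : ℝ} {π ρ : List E}

theorem GreedyRun.exists_first_step (h : N.GreedyRun π F) :
    (π = [] ∧ F = ∅) ∨ ∃ T ρ π', π = ρ ++ π' ∧ (N.contract (N.rooted ∅)).IsMinMax T ∧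
      ((N.contract (N.rooted ∅)).restrictTo
        (N.contractSub (N.extension T) (N.rooted ∅))).TreeGreedyOutput ρ := by
  induction h with
  | start => exact Or.inl ⟨rfl, rfl⟩
  | step π F T ρ _ _ hT hρ ih =>
    obtain ⟨rfl, rfl⟩ | ⟨T', ρ', π', rfl, h⟩ := ih
    · exact Or.inr ⟨T, ρ, [], by simp, hT, hρ⟩
    · exact Or.inr ⟨T', ρ', π' ++ ρ, by simp, h⟩

/-- A step of the algorithm for trees within the first min-max subtree `S`, where the edges of `X`
have been appended already and `e` is appended next. -/
structure InnerStep (N : Network V E) (S X S' : Set E) (lam : ℝ) (e : E) : Prop where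
  subset : S' ⊆ S
  feasible : N.Feasible (X ∪ S')
  mem : e ∈ S'
  eq : N.setPrize (X ∪ S') - N.setPrize X = lam * (N.setCost (X ∪ S') - N.setCost X)
  le : ∀ Y ⊆ S, N.Feasible Y → X ⊆ Y →
    N.setPrize Y - N.setPrize X ≤ lam * (N.setCost Y - N.setCost X)
  uniq : ∀ f ∈ S', N.Feasible (insert f X) → f = e

/-- In the first phase nothing has been contracted, so the inner run can be described directly in
`N`, with competitors ranging over feasible subsets of `S`. -/
theorem GreedyOutput.exists_first_phase (hN : N.Regular) (hcov : N.Coverable)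
    (h : N.GreedyOutput π) (htot : N.totalPrize ≠ N.setPrize ∅) :
    ∃ S lam ρ π', π = ρ ++ π' ∧ N.RelMinMax ∅ S lam ∧ S.Nonempty ∧ {f | f ∈ ρ} = S ∧ ρ.Nodup ∧
      (∀ i ≤ ρ.length, N.Feasible {f | f ∈ ρ.take i}) ∧
      ∀ i (hi : i < ρ.length), ∃ S' lam', N.InnerStep S {f | f ∈ ρ.take i} S' lam' ρ[i] := by
  obtain ⟨F, hrun, hzero⟩ := h
  have htot' : (N.contract (N.rooted ∅)).totalPrize ≠ 0 := by
    rw [totalPrize_contract hN.root_mem]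
    exact sub_ne_zero.2 htot
  obtain ⟨rfl, rfl⟩ | ⟨T, ρ, π', rfl, hT, hρ⟩ := hrun.exists_first_step
  · exact absurd hzero htot'
  obtain ⟨S₁, lam₁, -, -, hext, hall, hnd, hfeas, -⟩ :=
    RelMinMax.greedy_step hN hcov .empty htot' hT hρ
  obtain ⟨S, lam, rfl, hne, hS, hrel⟩ := hT.exists_relMinMax hN hcov .empty htot'
  rw [edgeSet_extension (Set.empty_subset _) hS.feasible] at hext
  subst hext
  refine ⟨S, lam, ρ, π', rfl, hrel, hne, hall, hnd, ?_, ?_⟩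
  · simpa using hfeas
  intro i hi
  rw [contractSub_extension (Set.empty_subset _) hS.feasible hne] at hρ
  have hM := hN.contract (F := ∅) (Set.empty_subset _)
  have hKfeas : ∀ Y, ((N.contract (N.rooted ∅)).restrictTo
      ((N.contract (N.rooted ∅)).rooted S)).Feasible Y ↔ N.Feasible Y ∧ Y ⊆ S := by
    intro Y
    rw [feasible_restrictTo_contract_iff .empty]
    simp
  have hKprize : ∀ Y ⊆ S, ((N.contract (N.rooted ∅)).restrictTo
      ((N.contract (N.rooted ∅)).rooted S)).setPrize Y = N.setPrize Y - N.setPrize ∅ := by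
    intro Y hY
    rw [setPrize_restrictTo_contract .empty hY (Set.disjoint_empty _), Set.empty_union]
  obtain ⟨S', lam', hstep, hmem, huniq⟩ :=
    hρ.1.exists_step hM.restrictTo (Coverable.restrictTo hS.feasible) i hi
  have hX := (hKfeas _).1 hstep.base
  have hXS := (hKfeas _).1 hstep.feasible
  have hS'S : S' ⊆ S := Set.subset_union_right.trans hXS.2
  refine ⟨S', lam', hS'S, hXS.1, hmem, ?_, ?_, ?_⟩
  · have := hstep.eq
    rw [hKprize _ hXS.2, hKprize _ hX.2, sub_sub_sub_cancel_right] at this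
    exact this
  · intro Y hYS hY hXY
    have := hstep.le Y ((hKfeas Y).2 ⟨hY, hYS⟩) hXY
    rw [hKprize _ hYS, hKprize _ hX.2, sub_sub_sub_cancel_right] at this
    exact this
  · intro f hf hfX
    exact huniq f hf ((hKfeas _).2 ⟨hfX, Set.insert_subset (hS'S hf) hX.2⟩)

/-- If no edge can be added after `e` that could not be added before, then the min-max subtree
consists of `e` only. -/
theorem InnerStep.union_eq (h : N.InnerStep S X S' lam e) (heX : N.Feasible (insert e X))
    (hsub : ∀ g ∈ S, g ∉ insert e X → N.Feasible (insert g (insert e X)) →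
      N.Feasible (insert g X)) : X ∪ S' = insert e X := by
  by_contra hne
  have hsub' : insert e X ⊆ X ∪ S' := Set.insert_subset (Or.inr h.mem) Set.subset_union_left
  have hss : insert e X ⊂ X ∪ S' := hsub'.ssubset_of_ne (Ne.symm hne)
  obtain ⟨g, hg, hgX, x, hx, y, hy, hl⟩ := heX.exists_insert h.feasible hss
  have hgS' : g ∈ S' := hg.resolve_left fun h => hgX (Or.inr h)
  refine hgX (Or.inl (h.uniq g hgS' ?_))
  exact hsub g (h.subset hgS') hgX (heX.insert hl hx hy)

theorem exists_isOpt (hr : N.root ∈ V(N.graph)) {B : ℝ} (hB : 0 ≤ B) : ∃ T, N.IsOpt B T := by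
  have hfin : {T | N.IsRootedSubtree T ∧ N.costOf T ≤ B}.Finite := by
    refine (Set.finite_range N.rooted).subset ?_
    rintro T ⟨hT, -⟩
    exact ⟨E(T), hT.eq_rooted.symm⟩
  obtain ⟨T, hT, hmax⟩ := Set.exists_max_image _ N.prizeOf hfin
    ⟨N.rooted ∅, Feasible.empty.isRootedSubtree hr, by
      rwa [costOf_rooted (Set.empty_subset _), setCost_empty]⟩
  exact ⟨T, hT, fun T' h h' => hmax T' ⟨h, h'⟩⟩

end Network

/-! ### An instance on which the algorithm makes a long detour

The root `0` is joined to every other vertex by an edge `(v, true)`. The edges `(v, false)` form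
together with `(1, true)` a tree that is the only min-max subtree. In it the algorithm walks along
the vertices `1`, `2`, `3`, and it only gains a prize at `3`. -/

namespace Detour

open Network

/-- The end of an edge that is nearer to the root. -/
def parent (e : Fin 8 × Bool) : Fin 8 :=
  if e.2 then 0 else if e.1 = 3 ∨ e.1 = 4 then 2 else 1

/-- The pairs that name edges. -/
def IsEdge (e : Fin 8 × Bool) : Prop := e.1 ≠ 0 ∧ e ≠ (1, false)

instance : DecidablePred IsEdge := fun _ => inferInstanceAs (Decidable (_ ∧ _))

/-- The cost of an edge. -/
def edgeCost (e : Fin 8 × Bool) : ℕ :=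
  if e.2 then if e.1 = 1 then 90 else 91
  else if e.1 = 2 then 51 else if e.1 = 3 ∨ e.1 = 4 then 42 else 69

/-- The prize of a vertex. -/
def vertexPrize (v : Fin 8) : ℕ :=
  if v = 0 ∨ v = 1 ∨ v = 2 then 0 else if v = 4 then 84 else 87

/-- The graph of the instance. -/
def graph : Graph (Fin 8) (Fin 8 × Bool) where
  vertexSet := Set.univ
  edgeSet := {e | IsEdge e}
  IsLink e x y := IsEdge e ∧ ((x = parent e ∧ y = e.1) ∨ (x = e.1 ∧ y = parent e))
  isLink_symm _ _ := ⟨fun _ _ h => ⟨h.1, h.2.symm.imp And.symm And.symm⟩⟩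
  eq_or_eq_of_isLink_of_isLink := by
    rintro e x y v w ⟨_, ⟨rfl, rfl⟩ | ⟨rfl, rfl⟩⟩ ⟨_, ⟨rfl, rfl⟩ | ⟨rfl, rfl⟩⟩ <;> simp
  edge_mem_iff_exists_isLink e :=
    ⟨fun h => ⟨parent e, e.1, h, Or.inl ⟨rfl, rfl⟩⟩, fun ⟨_, _, h⟩ => h.1⟩
  left_mem_of_isLink _ _ _ _ := Set.mem_univ _

/-- The network of the instance. -/
def net : Network (Fin 8) (Fin 8 × Bool) where
  graph := graph
  root := 0
  cost e := edgeCost e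
  prize v := vertexPrize v

theorem isLink_parent {e : Fin 8 × Bool} (he : IsEdge e) :
    net.graph.IsLink e (parent e) e.1 := ⟨he, Or.inl ⟨rfl, rfl⟩⟩

theorem inc_iff {e : Fin 8 × Bool} {v : Fin 8} :
    net.graph.Inc e v ↔ IsEdge e ∧ (v = parent e ∨ v = e.1) := by
  constructor
  · rintro ⟨y, h, ⟨rfl, -⟩ | ⟨rfl, -⟩⟩
    · exact ⟨h, Or.inl rfl⟩
    · exact ⟨h, Or.inr rfl⟩
  · rintro ⟨h, rfl | rfl⟩
    · exact (isLink_parent h).inc_left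
    · exact (isLink_parent h).inc_right

theorem mem_verts_iff {F : Set (Fin 8 × Bool)} {v : Fin 8} :
    v ∈ V(net.rooted F) ↔ v = 0 ∨ ∃ e ∈ F, IsEdge e ∧ (v = parent e ∨ v = e.1) := by
  simp only [mem_rooted, inc_iff]
  rfl

theorem regular : net.Regular where
  root_mem := Set.mem_univ _
  cost_pos e _ := by
    have : ∀ e, 0 < edgeCost e := by decide
    exact Nat.cast_pos.2 (this e)
  prize_nonneg _ _ := Nat.cast_nonneg _

theorem reachable_root (v : Fin 8) : Reachable net.graph 0 v := by
  by_cases hv : v = 0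
  · subst hv
    exact ⟨[], .nil (Set.mem_univ _)⟩
  · have he : IsEdge (v, true) := ⟨hv, by simp⟩
    exact ⟨[((v, true), v)], .cons (isLink_parent he) (.nil (Set.mem_univ _))⟩

/-- The instance. -/
def inst : Instance where
  V := Fin 8
  E := Fin 8 × Bool
  finite_V := inferInstance
  finite_E := inferInstance
  net := net
  root_mem := regular.root_mem
  cost_pos := regular.cost_pos
  prize_nonneg := regular.prize_nonneg
  reachable := fun v _ _ => reachable_root v

theorem inst_mem_connectedSimple : inst ∈ ConnectedSimple := by
  refine ⟨⟨⟨(0 : Fin 8), Set.mem_univ _⟩, fun u _ v _ => (reachable_root u).symm.trans (reachable_root v)⟩,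
    ?_, ?_⟩
  · have h1 : ∀ e, IsEdge e → parent e ≠ e.1 := by decide
    have h2 : ∀ e f, IsEdge e → IsEdge f → parent e = parent f → e.1 = f.1 → e = f := by decide
    have h3 : ∀ e f, IsEdge e → IsEdge f → parent e = f.1 → e.1 = parent f → e = f := by decide
    refine { not_isLoopAt := ?_, eq_of_isLink := ?_ }
    · rintro e x ⟨he, ⟨h, h'⟩ | ⟨h, h'⟩⟩
      · exact h1 e he (h.symm.trans h')
      · exact h1 e he (h'.symm.trans h)
    · rintro e f x y ⟨he, ⟨rfl, rfl⟩ | ⟨rfl, rfl⟩⟩ ⟨hf, ⟨h, h'⟩ | ⟨h, h'⟩⟩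
      · exact h2 e f he hf h h'
      · exact h3 e f he hf h h'
      · exact h3 e f he hf h' h
      · exact h2 e f he hf h' h
  · exact congrArg _ (show vertexPrize 0 = 0 by decide) |>.trans Nat.cast_zero

/-- The vertices of the rooted subgraph with edges `Y`. -/
def covered (Y : Finset (Fin 8 × Bool)) : Finset (Fin 8) :=
  {v | v = 0 ∨ ∃ e ∈ Y, IsEdge e ∧ (v = parent e ∨ v = e.1)}

theorem verts_coe (Y : Finset (Fin 8 × Bool)) :
    V(net.rooted (Y : Set (Fin 8 × Bool))) = (covered Y : Set (Fin 8)) := by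
  ext v
  rw [mem_verts_iff]
  simp [covered]

theorem setCost_coe (Y : Finset (Fin 8 × Bool)) :
    net.setCost (Y : Set (Fin 8 × Bool)) = ((∑ e ∈ Y, edgeCost e : ℕ) : ℝ) := by
  rw [setCost, finsum_mem_coe_finset, Nat.cast_sum]
  rfl

theorem setPrize_coe (Y : Finset (Fin 8 × Bool)) :
    net.setPrize (Y : Set (Fin 8 × Bool)) = ((∑ v ∈ covered Y, vertexPrize v : ℕ) : ℝ) := by
  rw [setPrize, prizeOf, verts_coe, finsum_mem_coe_finset, Nat.cast_sum]
  rfl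

theorem feasible_empty : net.Feasible ((∅ : Finset (Fin 8 × Bool)) : Set (Fin 8 × Bool)) := by
  rw [Finset.coe_empty]
  exact .empty

theorem feasible_insert {Y : Finset (Fin 8 × Bool)} {e : Fin 8 × Bool}
    (hY : net.Feasible (Y : Set (Fin 8 × Bool)))
    (h : IsEdge e ∧ parent e ∈ covered Y ∧ e.1 ∉ covered Y) :
    net.Feasible ((insert e Y : Finset (Fin 8 × Bool)) : Set (Fin 8 × Bool)) := by
  rw [Finset.coe_insert]
  refine hY.insert (isLink_parent h.1) ?_ ?_
  · rw [verts_coe]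
    exact h.2.1
  · rw [verts_coe]
    exact h.2.2

/-- The edges of the min-max subtree. -/
def tree : Finset (Fin 8 × Bool) :=
  {(7, false), (6, false), (5, false), (4, false), (3, false), (2, false), (1, true)}

theorem feasible_one : net.Feasible (({(1, true)} : Finset (Fin 8 × Bool)) : Set _) := by
  have := feasible_insert (e := (1, true)) feasible_empty (by decide)
  exact this

theorem feasible_two :
    net.Feasible (({(2, false), (1, true)} : Finset (Fin 8 × Bool)) : Set _) :=
  feasible_insert feasible_one (by decide)

theorem feasible_three :
    net.Feasible (({(3, false), (2, false), (1, true)} : Finset (Fin 8 × Bool)) : Set _) :=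
  feasible_insert feasible_two (by decide)

theorem feasible_four : net.Feasible
    (({(4, false), (3, false), (2, false), (1, true)} : Finset (Fin 8 × Bool)) : Set _) :=
  feasible_insert feasible_three (by decide)

theorem feasible_tree : net.Feasible (tree : Set (Fin 8 × Bool)) :=
  feasible_insert (feasible_insert (feasible_insert feasible_four (by decide)) (by decide))
    (by decide)

/-! ### Only one nonempty rooted subtree of the instance reaches density one -/

section Value

open Classical in
theorem setCost_eq {S : Set (Fin 8 × Bool)} :
    net.setCost S = ∑ v : Fin 8, ((if (v, true) ∈ S then (edgeCost (v, true) : ℝ) else 0) +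
      if (v, false) ∈ S then (edgeCost (v, false) : ℝ) else 0) := by
  rw [setCost, finsum_mem_def, finsum_eq_sum_of_fintype, Fintype.sum_prod_type]
  refine Finset.sum_congr rfl fun v _ => ?_
  rw [Fintype.sum_bool, Set.indicator_apply, Set.indicator_apply]
  rfl

open Classical in
theorem setPrize_eq {S : Set (Fin 8 × Bool)} :
    net.setPrize S = ∑ v : Fin 8, if v ∈ V(net.rooted S) then (vertexPrize v : ℝ) else 0 := by
  rw [setPrize, prizeOf, finsum_mem_def, finsum_eq_sum_of_fintype]
  refine Finset.sum_congr rfl fun v _ => ?_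
  rw [Set.indicator_apply]
  rfl


theorem mem_verts_iff_of_leaf {S : Set (Fin 8 × Bool)} {v : Fin 8} (hv : 3 ≤ v) :
    v ∈ V(net.rooted S) ↔ (v, true) ∈ S ∨ (v, false) ∈ S := by
  have h0 : v ≠ 0 := by
    rintro rfl
    revert hv
    decide
  have h1 : ∀ v : Fin 8, 3 ≤ v → ∀ e, v ≠ parent e := by decide
  have h2 : ∀ v : Fin 8, 3 ≤ v → ∀ b, IsEdge (v, b) := by decide
  rw [mem_verts_iff]
  constructor
  · rintro (h | ⟨⟨w, b⟩, he, -, h | h⟩)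
    · exact absurd h h0
    · exact absurd h (h1 v hv _)
    · simp only at h
      subst h
      cases b
      · exact Or.inr he
      · exact Or.inl he
  · rintro (h | h)
    · exact Or.inr ⟨_, h, h2 v hv _, Or.inr rfl⟩
    · exact Or.inr ⟨_, h, h2 v hv _, Or.inr rfl⟩

/-- A feasible set that reaches a vertex set without the root contains an edge that enters it. -/
theorem exists_entering {S : Set (Fin 8 × Bool)} (hS : net.Feasible S) {W : Set (Fin 8)}
    {e : Fin 8 × Bool} (he : e ∈ S) (h0 : 0 ∉ W) (heW : e.1 ∈ W) :
    ∃ f ∈ S, IsEdge f ∧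
      ((parent f ∉ W ∧ f.1 ∈ W) ∨ (f.2 = false ∧ f.1 ∉ W ∧ parent f ∈ W)) := by
  have hev : e.1 ∈ V(net.rooted S) :=
    mem_rooted_of_inc he (inc_iff.2 ⟨hS.subset he, Or.inr rfl⟩)
  obtain ⟨f, hf, x, hx, y, hy, hfe, h⟩ := hS.exists_link_leaving (W := Wᶜ) h0 hev
    (Set.notMem_compl_iff.2 heW)
  rw [Set.notMem_compl_iff] at hy
  refine ⟨f, hf, hfe, ?_⟩
  obtain ⟨rfl, rfl⟩ | ⟨rfl, rfl⟩ := h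
  · exact Or.inl ⟨hx, hy⟩
  · refine Or.inr ⟨?_, hx, hy⟩
    by_contra hb
    rw [Bool.not_eq_false] at hb
    rw [parent, if_pos hb] at hy
    exact h0 hy

open Classical in
/-- The contribution of a leaf with prize `P` and edge cost `c` to the difference of prize and cost,
where `p` and `q` tell whether the root edge and the tree edge of the leaf are used. -/
theorem leaf_value (p q : Prop) {P c t : ℝ} (hc : 42 ≤ c) (hc' : c ≤ 69) (hP : c + 18 ≤ P)
    (hP' : P ≤ 87)
    (ht : t = (if p ∨ q then P else 0) - ((if p then 91 else 0) + if q then c else 0)) :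
    t ≤ P - c ∧ (¬ q → t ≤ 0) ∧ (p ∧ q → t ≤ P - c - 91) ∧ (¬ (q ∧ ¬ p) → t ≤ P - c - 18) ∧
      (p → ¬ q → t < 0) := by
  by_cases hp : p <;> by_cases hq : q <;> simp only [hp, hq, true_or, or_true, or_self, if_true,
    if_false] at ht <;> subst ht <;>
    refine ⟨?_, fun h => ?_, fun h => ?_, fun h => ?_, fun h h' => ?_⟩ <;>
    first
      | linarith
      | simp_all

open Classical in
/-- The difference of prize and cost as a sum over the leaves and the other edges. -/
theorem exists_leaf_values {S : Set (Fin 8 × Bool)} (hS : S ⊆ E(net.graph)) :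
    ∃ t : Fin 8 → ℝ, net.setPrize S - net.setCost S = t 3 + t 4 + t 5 + t 6 + t 7 -
      ((if ((1 : Fin 8), true) ∈ S then 90 else 0) + (if ((2 : Fin 8), true) ∈ S then 91 else 0) +
        if ((2 : Fin 8), false) ∈ S then 51 else 0) ∧
      ∀ v : Fin 8, 3 ≤ v → t v ≤ (vertexPrize v : ℝ) - edgeCost (v, false) ∧
        ((v, false) ∉ S → t v ≤ 0) ∧
        ((v, true) ∈ S ∧ (v, false) ∈ S → t v ≤ (vertexPrize v : ℝ) - edgeCost (v, false) - 91) ∧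
        (¬ ((v, false) ∈ S ∧ (v, true) ∉ S) →
          t v ≤ (vertexPrize v : ℝ) - edgeCost (v, false) - 18) ∧
        ((v, true) ∈ S → (v, false) ∉ S → t v < 0) := by
  have n0 : ∀ b, ((0 : Fin 8), b) ∉ S := fun b h => (hS h).1 rfl
  have n1 : ((1 : Fin 8), false) ∉ S := fun h => (hS h).2 rfl
  refine ⟨fun v => (if (v, true) ∈ S ∨ (v, false) ∈ S then (vertexPrize v : ℝ) else 0) -
    ((if (v, true) ∈ S then 91 else 0) +
      if (v, false) ∈ S then (edgeCost (v, false) : ℝ) else 0), ?_, ?_⟩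
  · rw [setPrize_eq, setCost_eq, Fin.sum_univ_eight, Fin.sum_univ_eight,
      if_congr (mem_verts_iff_of_leaf (S := S) (v := 3) (by decide)) rfl rfl,
      if_congr (mem_verts_iff_of_leaf (S := S) (v := 4) (by decide)) rfl rfl,
      if_congr (mem_verts_iff_of_leaf (S := S) (v := 5) (by decide)) rfl rfl,
      if_congr (mem_verts_iff_of_leaf (S := S) (v := 6) (by decide)) rfl rfl,
      if_congr (mem_verts_iff_of_leaf (S := S) (v := 7) (by decide)) rfl rfl]
    have c1 : edgeCost (1, true) = 90 := rfl
    have c2 : edgeCost (2, false) = 51 := rfl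
    have c3 : ∀ v : Fin 8, v ≠ 1 → edgeCost (v, true) = 91 := by decide
    have p0 : vertexPrize 0 = 0 := rfl
    have p1 : vertexPrize 1 = 0 := rfl
    have p2 : vertexPrize 2 = 0 := rfl
    simp only [n0, n1, if_false, c1, c2, c3 2 (by decide), c3 3 (by decide), c3 4 (by decide),
      c3 5 (by decide), c3 6 (by decide), c3 7 (by decide), p0, p1, p2, Nat.cast_zero, ite_self,
      Nat.cast_ofNat]
    ring
  · intro v hv
    have h : ∀ v : Fin 8, 3 ≤ v → 42 ≤ edgeCost (v, false) ∧ edgeCost (v, false) ≤ 69 ∧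
      edgeCost (v, false) + 18 ≤ vertexPrize v ∧ vertexPrize v ≤ 87 := by decide
    obtain ⟨h1, h2, h3, h4⟩ := h v hv
    exact leaf_value _ _ (by exact_mod_cast h1) (by exact_mod_cast h2) (by exact_mod_cast h3)
      (by exact_mod_cast h4) rfl

theorem exists_root_edge_of_mem {S : Set (Fin 8 × Bool)} (hS : net.Feasible S)
    (h : ((2 : Fin 8), false) ∈ S) : ((1 : Fin 8), true) ∈ S ∨ ((2 : Fin 8), true) ∈ S ∨
      ∃ v : Fin 8, 3 ≤ v ∧ (v, true) ∈ S ∧ (v, false) ∈ S := by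
  obtain ⟨⟨w, b⟩, hf, hfe, h⟩ := exists_entering hS
    -- This set is closed under the tree edges in `S`, with either end inside, so only a root edge
    -- can enter it. The two lemmas below argue likewise with the branches at `1` and at `2`.
    (W := {v | v = 1 ∨ v = 2 ∨ (3 ≤ v ∧ (v, false) ∈ S)}) h (by simp) (Or.inr (Or.inl rfl))
  have hpar : ∀ w : Fin 8, parent (w, false) = 1 ∨ parent (w, false) = 2 := by decide
  have hlt : ∀ w : Fin 8, w ≠ 0 → w = 1 ∨ w = 2 ∨ 3 ≤ w := by decide
  obtain ⟨h1, h2⟩ | ⟨rfl, h1, h2⟩ := h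
  · cases b
    · exact absurd ((hpar w).imp_right Or.inl) h1
    · obtain rfl | rfl | ⟨h3, h4⟩ := h2
      · exact Or.inl hf
      · exact Or.inr (Or.inl hf)
      · exact Or.inr (Or.inr ⟨w, h3, hf, h4⟩)
  · exact absurd ((hlt w hfe.1).imp_right (Or.imp_right fun h => ⟨h, hf⟩)) h1

theorem exists_root_edge_of_upper {S : Set (Fin 8 × Bool)} (hS : net.Feasible S)
    (h2 : ((2 : Fin 8), false) ∉ S) {u : Fin 8} (hu : 5 ≤ u) (h : (u, false) ∈ S) :
    ((1 : Fin 8), true) ∈ S ∨ ∃ v : Fin 8, 5 ≤ v ∧ (v, true) ∈ S ∧ (v, false) ∈ S := by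
  obtain ⟨⟨w, b⟩, hf, hfe, h⟩ := exists_entering hS
    (W := {v | v = 1 ∨ (5 ≤ v ∧ (v, false) ∈ S)}) h (by simp) (Or.inr ⟨hu, h⟩)
  have hpar : ∀ w : Fin 8, 5 ≤ w → parent (w, false) = 1 := by decide
  have hpar' : ∀ w : Fin 8, IsEdge (w, false) → w = 2 ∨ 5 ≤ w ∨ parent (w, false) = 2 := by decide
  obtain ⟨h1, h3⟩ | ⟨rfl, h1, h3⟩ := h
  · cases b
    · obtain rfl | ⟨h3, -⟩ := h3
      · exact absurd rfl hfe.2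
      · exact absurd (Or.inl (hpar w h3)) h1
    · obtain rfl | ⟨h3, h4⟩ := h3
      · exact Or.inl hf
      · exact Or.inr ⟨w, h3, hf, h4⟩
  · obtain rfl | h4 | h4 := hpar' w hfe
    · exact absurd hf h2
    · exact absurd (Or.inr ⟨h4, hf⟩) h1
    · rw [h4] at h3
      obtain h3 | ⟨h3, -⟩ := h3
      · exact absurd h3 (by decide)
      · exact absurd h3 (by decide)

theorem exists_root_edge_of_lower {S : Set (Fin 8 × Bool)} (hS : net.Feasible S)
    (h2 : ((2 : Fin 8), false) ∉ S) {u : Fin 8} (hu : u = 3 ∨ u = 4) (h : (u, false) ∈ S) :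
    ((2 : Fin 8), true) ∈ S ∨ ∃ v : Fin 8, (v = 3 ∨ v = 4) ∧ (v, true) ∈ S ∧ (v, false) ∈ S := by
  obtain ⟨⟨w, b⟩, hf, hfe, h⟩ := exists_entering hS
    (W := {v | v = 2 ∨ ((v = 3 ∨ v = 4) ∧ (v, false) ∈ S)}) h (by simp) (Or.inr ⟨hu, h⟩)
  have hpar : ∀ w : Fin 8, (w = 3 ∨ w = 4) → parent (w, false) = 2 := by decide
  have hpar' : ∀ w : Fin 8, (w = 3 ∨ w = 4) ∨ parent (w, false) = 1 := by decide
  obtain ⟨h1, h3⟩ | ⟨rfl, h1, h3⟩ := h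
  · cases b
    · obtain rfl | ⟨h3, -⟩ := h3
      · exact absurd hf h2
      · exact absurd (Or.inl (hpar w h3)) h1
    · obtain rfl | ⟨h3, h4⟩ := h3
      · exact Or.inl hf
      · exact Or.inr ⟨w, h3, hf, h4⟩
  · obtain h4 | h4 := hpar' w
    · exact absurd (Or.inr ⟨h4, hf⟩) h1
    · rw [h4] at h3
      obtain h3 | ⟨h3, -⟩ := h3
      · exact absurd h3 (by decide)
      · exact absurd h3 (by decide)

theorem leaf_cases : ∀ v : Fin 8, 3 ≤ v → v = 3 ∨ v = 4 ∨ v = 5 ∨ v = 6 ∨ v = 7 := by decide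

/-- Apart from the empty one and `tree`, all rooted subtrees have density less than `1`. -/
theorem setPrize_lt_or {S : Set (Fin 8 × Bool)} (hS : net.Feasible S) :
    net.setPrize S < net.setCost S ∨ S = ∅ ∨ S = tree := by
  classical
  have hsub := hS.subset
  obtain ⟨t, key, ht⟩ := exists_leaf_values hsub
  have g3 : ((vertexPrize 3 : ℕ) : ℝ) - edgeCost (3, false) = 45 := by
    rw [show vertexPrize 3 = 87 from rfl, show edgeCost (3, false) = 42 from rfl]; norm_num
  have g4 : ((vertexPrize 4 : ℕ) : ℝ) - edgeCost (4, false) = 42 := by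
    rw [show vertexPrize 4 = 84 from rfl, show edgeCost (4, false) = 42 from rfl]; norm_num
  have g5 : ((vertexPrize 5 : ℕ) : ℝ) - edgeCost (5, false) = 18 := by
    rw [show vertexPrize 5 = 87 from rfl, show edgeCost (5, false) = 69 from rfl]; norm_num
  have g6 : ((vertexPrize 6 : ℕ) : ℝ) - edgeCost (6, false) = 18 := by
    rw [show vertexPrize 6 = 87 from rfl, show edgeCost (6, false) = 69 from rfl]; norm_num
  have g7 : ((vertexPrize 7 : ℕ) : ℝ) - edgeCost (7, false) = 18 := by
    rw [show vertexPrize 7 = 87 from rfl, show edgeCost (7, false) = 69 from rfl]; norm_num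
  obtain ⟨a3, b3, c3, d3, e3⟩ := ht 3 (by decide)
  obtain ⟨a4, b4, c4, d4, e4⟩ := ht 4 (by decide)
  obtain ⟨a5, b5, c5, d5, e5⟩ := ht 5 (by decide)
  obtain ⟨a6, b6, c6, d6, e6⟩ := ht 6 (by decide)
  obtain ⟨a7, b7, c7, d7, e7⟩ := ht 7 (by decide)
  rw [g3] at a3 c3 d3
  rw [g4] at a4 c4 d4
  rw [g5] at a5 c5 d5
  rw [g6] at a6 c6 d6
  rw [g7] at a7 c7 d7
  obtain ⟨i1, hi1⟩ : ∃ i : ℝ, i = if ((1 : Fin 8), true) ∈ S then 90 else 0 := ⟨_, rfl⟩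
  obtain ⟨i2, hi2⟩ : ∃ i : ℝ, i = if ((2 : Fin 8), true) ∈ S then 91 else 0 := ⟨_, rfl⟩
  have hi1' : 0 ≤ i1 := by rw [hi1]; split_ifs <;> norm_num
  have hi2' : 0 ≤ i2 := by rw [hi2]; split_ifs <;> norm_num
  rw [← hi1, ← hi2] at key
  by_cases h2 : ((2 : Fin 8), false) ∈ S
  · rw [if_pos h2] at key
    obtain h | h | ⟨v, hv, h⟩ := exists_root_edge_of_mem hS h2
    · rw [if_pos h] at hi1
      by_cases h3 : (((3 : Fin 8), false) ∈ S ∧ ((3 : Fin 8), true) ∉ S)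
      swap
      · left; linarith [d3 h3]
      by_cases h4 : (((4 : Fin 8), false) ∈ S ∧ ((4 : Fin 8), true) ∉ S)
      swap
      · left; linarith [d4 h4]
      by_cases h5 : (((5 : Fin 8), false) ∈ S ∧ ((5 : Fin 8), true) ∉ S)
      swap
      · left; linarith [d5 h5]
      by_cases h6 : (((6 : Fin 8), false) ∈ S ∧ ((6 : Fin 8), true) ∉ S)
      swap
      · left; linarith [d6 h6]
      by_cases h7 : (((7 : Fin 8), false) ∈ S ∧ ((7 : Fin 8), true) ∉ S)
      swap
      · left; linarith [d7 h7]
      by_cases h2' : ((2 : Fin 8), true) ∈ S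
      · rw [if_pos h2'] at hi2
        left; linarith
      right; right
      refine subset_antisymm (fun e he => ?_) ?_
      · have : ∀ e, IsEdge e → e ∈ tree ∨ e = (2, true) ∨ e = (3, true) ∨ e = (4, true) ∨
          e = (5, true) ∨ e = (6, true) ∨ e = (7, true) := by decide
        obtain h | rfl | rfl | rfl | rfl | rfl | rfl := this e (hsub he)
        · exact h
        · exact absurd he h2'
        · exact absurd he h3.2
        · exact absurd he h4.2
        · exact absurd he h5.2
        · exact absurd he h6.2
        · exact absurd he h7.2
      · simp only [tree, Finset.coe_insert, Finset.coe_singleton, Set.insert_subset_iff,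
          Set.singleton_subset_iff]
        exact ⟨h7.1, h6.1, h5.1, h4.1, h3.1, h2, h⟩
    · rw [if_pos h] at hi2
      left; linarith
    · left
      obtain rfl | rfl | rfl | rfl | rfl := leaf_cases v hv
      · linarith [c3 h]
      · linarith [c4 h]
      · linarith [c5 h]
      · linarith [c6 h]
      · linarith [c7 h]
  · rw [if_neg h2] at key
    -- Without `(2, false)` the branches at `1` and `2` are balanced separately: gains of at most 54
    -- and 87 against an entrance cost of at least 90 and 91.
    have upper : t 5 + t 6 + t 7 - i1 < 0 ∨
        (t 5 + t 6 + t 7 - i1 ≤ 0 ∧ ∀ v : Fin 8, 5 ≤ v → (v, false) ∉ S) := by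
      by_cases h : ∃ u : Fin 8, 5 ≤ u ∧ (u, false) ∈ S
      · left
        obtain ⟨u, hu, h⟩ := h
        obtain h | ⟨v, hv, h⟩ := exists_root_edge_of_upper hS h2 hu h
        · rw [if_pos h] at hi1
          linarith
        · have : ∀ v : Fin 8, 5 ≤ v → v = 5 ∨ v = 6 ∨ v = 7 := by decide
          obtain rfl | rfl | rfl := this v hv
          · linarith [c5 h]
          · linarith [c6 h]
          · linarith [c7 h]
      · right
        push Not at h
        exact ⟨by linarith [b5 (h 5 (by decide)), b6 (h 6 (by decide)), b7 (h 7 (by decide))], h⟩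
    have lower : t 3 + t 4 - i2 < 0 ∨
        (t 3 + t 4 - i2 ≤ 0 ∧ ((3 : Fin 8), false) ∉ S ∧ ((4 : Fin 8), false) ∉ S) := by
      by_cases h : ∃ u : Fin 8, (u = 3 ∨ u = 4) ∧ (u, false) ∈ S
      · left
        obtain ⟨u, hu, h⟩ := h
        obtain h | ⟨v, rfl | rfl, h⟩ := exists_root_edge_of_lower hS h2 hu h
        · rw [if_pos h] at hi2
          linarith
        · linarith [c3 h]
        · linarith [c4 h]
      · right
        push Not at h
        have h3 := h 3 (Or.inl rfl)
        have h4 := h 4 (Or.inr rfl)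
        exact ⟨by linarith [b3 h3, b4 h4], h3, h4⟩
    obtain hu | ⟨hu, u5⟩ := upper
    · left
      obtain hl | ⟨hl, -⟩ := lower <;> linarith
    obtain hl | ⟨hl, u3, u4⟩ := lower
    · left; linarith
    have u5' := u5 5 (by decide)
    have u6' := u5 6 (by decide)
    have u7' := u5 7 (by decide)
    by_cases hempty : S = ∅
    · exact Or.inr (Or.inl hempty)
    left
    have hb3 := b3 u3
    have hb4 := b4 u4
    have hb5 := b5 u5'
    have hb6 := b6 u6'
    have hb7 := b7 u7'
    obtain ⟨e, he⟩ := Set.nonempty_iff_ne_empty.2 hempty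
    have hcases : ∀ e, IsEdge e → e = (1, true) ∨ e = (2, true) ∨ e = (3, true) ∨ e = (4, true) ∨
      e = (5, true) ∨ e = (6, true) ∨ e = (7, true) ∨ e = (2, false) ∨ e = (3, false) ∨
      e = (4, false) ∨ e = (5, false) ∨ e = (6, false) ∨ e = (7, false) := by decide
    obtain rfl | rfl | rfl | rfl | rfl | rfl | rfl | rfl | rfl | rfl | rfl | rfl | rfl :=
      hcases e (hsub he)
    · rw [if_pos he] at hi1
      linarith
    · rw [if_pos he] at hi2
      linarith
    · linarith [e3 he u3]
    · linarith [e4 he u4]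
    · linarith [e5 he u5']
    · linarith [e6 he u6']
    · linarith [e7 he u7']
    · exact absurd he h2
    · exact absurd he u3
    · exact absurd he u4
    · exact absurd he u5'
    · exact absurd he u6'
    · exact absurd he u7'

end Value

end Detour

/-! ### The run on the detour instance -/

namespace Detour

open Network

theorem two_mem_of_feasible {Y : Set (Fin 8 × Bool)} (hY : net.Feasible Y) (hsub : Y ⊆ tree)
    {e : Fin 8 × Bool} (he : e ∈ Y) (h : e = (3, false) ∨ e = (4, false)) :
    ((2 : Fin 8), false) ∈ Y := by
  obtain ⟨f, hf, -, h⟩ := exists_entering hY (W := (({2, 3, 4} : Finset (Fin 8)) : Set (Fin 8)))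
    he (by decide) (by obtain rfl | rfl := h <;> decide)
  have h1 : ∀ f ∈ tree, (parent f ∉ ({2, 3, 4} : Finset (Fin 8)) ∧
    f.1 ∈ ({2, 3, 4} : Finset (Fin 8))) ∨ (f.2 = false ∧ f.1 ∉ ({2, 3, 4} : Finset (Fin 8)) ∧
      parent f ∈ ({2, 3, 4} : Finset (Fin 8))) → f = (2, false) := by decide
  rwa [← h1 f (hsub hf) h]

theorem one_mem_of_feasible {Y : Set (Fin 8 × Bool)} (hY : net.Feasible Y) (hsub : Y ⊆ tree)
    (hne : Y.Nonempty) : ((1 : Fin 8), true) ∈ Y := by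
  obtain ⟨e, he⟩ := hne
  have h0 : ∀ f ∈ tree, f.1 ≠ 0 := by decide
  obtain ⟨f, hf, -, h⟩ := exists_entering hY (W := {v | v ≠ 0}) he (fun h => h rfl)
    (h0 e (hsub he))
  have h1 : ∀ f ∈ tree, parent f = 0 → f = (1, true) := by decide
  obtain ⟨h, -⟩ | ⟨-, h, -⟩ := h
  · rwa [← h1 f (hsub hf) (not_not.1 h)]
  · exact absurd (h0 f (hsub hf)) h

theorem setCost_coe_eq {Y : Finset (Fin 8 × Bool)} {n : ℕ} (h : ∑ e ∈ Y, edgeCost e = n) :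
    net.setCost (Y : Set (Fin 8 × Bool)) = n := by
  rw [setCost_coe, h]

theorem setPrize_coe_eq {Y : Finset (Fin 8 × Bool)} {n : ℕ}
    (h : ∑ v ∈ covered Y, vertexPrize v = n) :
    net.setPrize (Y : Set (Fin 8 × Bool)) = n := by
  rw [setPrize_coe, h]

theorem setPrize_empty_eq : net.setPrize ∅ = 0 := by
  rw [setPrize_empty]
  exact congrArg _ (show vertexPrize 0 = 0 by decide) |>.trans Nat.cast_zero

theorem setCost_one :
    net.setCost (({(1, true)} : Finset (Fin 8 × Bool)) : Set _) = (90 : ℕ) :=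
  setCost_coe_eq (by decide)

theorem setPrize_one :
    net.setPrize (({(1, true)} : Finset (Fin 8 × Bool)) : Set _) = (0 : ℕ) :=
  setPrize_coe_eq (by decide)

theorem setCost_two :
    net.setCost (({(2, false), (1, true)} : Finset (Fin 8 × Bool)) : Set _) = (141 : ℕ) :=
  setCost_coe_eq (by decide)

theorem setPrize_two :
    net.setPrize (({(2, false), (1, true)} : Finset (Fin 8 × Bool)) : Set _) = (0 : ℕ) :=
  setPrize_coe_eq (by decide)

/-- `tree` has prize and cost 432, so the maximum density is at least 1, and `setPrize_lt_or` leaves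
no other candidate. -/
theorem eq_tree_of_relMinMax {S : Set (Fin 8 × Bool)} {lam : ℝ} (h : net.RelMinMax ∅ S lam)
    (hne : S.Nonempty) : S = tree := by
  have hf := h.feasible
  have heq := h.eq
  have hle := h.le _ feasible_tree (Set.empty_subset _)
  rw [Set.empty_union] at hf heq
  rw [setPrize_empty_eq, setCost_empty, sub_zero, sub_zero] at heq hle
  have h1 : net.setPrize (tree : Set (Fin 8 × Bool)) = (432 : ℕ) := setPrize_coe_eq (by decide)
  have h2 : net.setCost (tree : Set (Fin 8 × Bool)) = (432 : ℕ) := setCost_coe_eq (by decide)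
  rw [h1, h2] at hle
  have hlam : 1 ≤ lam := by
    push_cast at hle
    linarith
  have h3 := regular.setCost_nonneg hf.subset
  obtain h | h | h := setPrize_lt_or hf
  · nlinarith
  · exact absurd h hne.ne_empty
  · exact h

/-- After `(1, true)` the branch through `2` has density 171/135, slightly more than the 87/69 of a
leaf at `1`, although its first edge earns nothing. -/
theorem second_edge {S' : Set (Fin 8 × Bool)} {lam : ℝ} {e : Fin 8 × Bool}
    (h : net.InnerStep tree (({(1, true)} : Finset (Fin 8 × Bool)) : Set _) S' lam e)
    (hne : e ≠ (1, true))
    (hf : net.Feasible (insert e (({(1, true)} : Finset (Fin 8 × Bool)) : Set _))) :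
    e = (2, false) := by
  have hetree : e ∈ tree := h.subset h.mem
  have hone : ((1 : Fin 8), true) ∈ tree := by decide
  have hsub1 : (({(1, true)} : Finset (Fin 8 × Bool)) : Set (Fin 8 × Bool)) ⊆
      (tree : Set (Fin 8 × Bool)) := by
    rw [Finset.coe_singleton]
    exact Set.singleton_subset_iff.2 hone
  have hcases : ∀ e ∈ tree, e ≠ (1, true) → e = (2, false) ∨ (e = (3, false) ∨ e = (4, false)) ∨
    (e = (5, false) ∨ e = (6, false) ∨ e = (7, false)) := by decide
  obtain he | he | he := hcases e hetree hne
  · exact he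
  · have := two_mem_of_feasible hf (Set.insert_subset hetree hsub1) (Set.mem_insert _ _) he
    rw [Finset.coe_singleton] at this
    obtain h | h := this
    · exact h.symm
    · exact absurd h (by decide)
  · exfalso
    -- Adding a leaf makes no further edge available, so its min-max subtree would be the leaf edge
    -- alone.
    have hU := h.union_eq hf (by
      intro g hg hgX hgf
      have hg1 : g ≠ (1, true) := fun h => hgX (Or.inr (by simp [h]))
      obtain rfl | hg' | hg' := hcases g hg hg1
      · have := feasible_insert (e := (2, false)) feasible_one (by decide)
        rwa [Finset.coe_insert] at this
      · have := two_mem_of_feasible hgf (Set.insert_subset hg (Set.insert_subset hetree hsub1))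
          (Set.mem_insert _ _) hg'
        rw [Finset.coe_singleton] at this
        obtain h | h | h := this
        · rw [← h] at hg'
          exact absurd hg' (by decide)
        · rw [← h] at he
          exact absurd he (by decide)
        · exact absurd h (by decide)
      · have := feasible_insert (e := g) feasible_one
          (by obtain rfl | rfl | rfl := hg' <;> decide)
        rwa [Finset.coe_insert] at this)
    have heq := h.eq
    have hle := h.le (({(4, false), (3, false), (2, false), (1, true)} :
      Finset (Fin 8 × Bool)) : Set _) (Finset.coe_subset.2 (by decide)) feasible_four
      (Finset.coe_subset.2 (by decide))
    rw [hU, ← Finset.coe_insert] at heq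
    have hc : net.setCost ((insert e {(1, true)} : Finset (Fin 8 × Bool)) : Set _) = (159 : ℕ) :=
      setCost_coe_eq (by obtain rfl | rfl | rfl := he <;> decide)
    have hp : net.setPrize ((insert e {(1, true)} : Finset (Fin 8 × Bool)) : Set _) = (87 : ℕ) :=
      setPrize_coe_eq (by obtain rfl | rfl | rfl := he <;> decide)
    have hc' : net.setCost (({(4, false), (3, false), (2, false), (1, true)} :
      Finset (Fin 8 × Bool)) : Set _) = (225 : ℕ) := setCost_coe_eq (by decide)
    have hp' : net.setPrize (({(4, false), (3, false), (2, false), (1, true)} :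
      Finset (Fin 8 × Bool)) : Set _) = (171 : ℕ) := setPrize_coe_eq (by decide)
    rw [hc, hp, setCost_one, setPrize_one] at heq
    rw [hc', hp', setCost_one, setPrize_one] at hle
    push_cast at heq hle
    linarith

/-- Every remaining edge leads to a leaf, so only single edges compete, and 87/42 beats 84/42 and
87/69. -/
theorem third_edge {S' : Set (Fin 8 × Bool)} {lam : ℝ} {e : Fin 8 × Bool}
    (h : net.InnerStep tree (({(2, false), (1, true)} : Finset (Fin 8 × Bool)) : Set _) S' lam e)
    (hne : e ≠ (1, true)) (hne' : e ≠ (2, false)) : e = (3, false) := by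
  have hetree : e ∈ tree := h.subset h.mem
  have hcases : ∀ e ∈ tree, e ≠ (1, true) → e ≠ (2, false) → e = (3, false) ∨ (e = (4, false) ∨
    e = (5, false) ∨ e = (6, false) ∨ e = (7, false)) := by decide
  have hfeas : ∀ g ∈ tree, g ≠ (1, true) → g ≠ (2, false) → net.Feasible
      (insert g (({(2, false), (1, true)} : Finset (Fin 8 × Bool)) : Set _)) := by
    intro g hg h1 h2
    rw [← Finset.coe_insert]
    exact feasible_insert feasible_two
      (by obtain rfl | rfl | rfl | rfl | rfl := hcases g hg h1 h2 <;> decide)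
  obtain he | he := hcases e hetree hne hne'
  · exact he
  · exfalso
    have hU := h.union_eq (hfeas e hetree hne hne') (by
      intro g hg hgX _
      exact hfeas g hg (fun h => hgX (Or.inr (by simp [h]))) fun h => hgX (Or.inr (by simp [h])))
    have heq := h.eq
    have hle := h.le (({(3, false), (2, false), (1, true)} :
      Finset (Fin 8 × Bool)) : Set _) (Finset.coe_subset.2 (by decide)) feasible_three
      (Finset.coe_subset.2 (by decide))
    have hc' : net.setCost (({(3, false), (2, false), (1, true)} :
      Finset (Fin 8 × Bool)) : Set _) = (183 : ℕ) := setCost_coe_eq (by decide)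
    have hp' : net.setPrize (({(3, false), (2, false), (1, true)} :
      Finset (Fin 8 × Bool)) : Set _) = (87 : ℕ) := setPrize_coe_eq (by decide)
    rw [hc', hp', setCost_two, setPrize_two] at hle
    rw [hU, ← Finset.coe_insert] at heq
    obtain rfl | he := he
    · have hc : net.setCost ((insert (4, false) {(2, false), (1, true)} :
          Finset (Fin 8 × Bool)) : Set _) = (183 : ℕ) := setCost_coe_eq (by decide)
      have hp : net.setPrize ((insert (4, false) {(2, false), (1, true)} :
          Finset (Fin 8 × Bool)) : Set _) = (84 : ℕ) := setPrize_coe_eq (by decide)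
      rw [hc, hp, setCost_two, setPrize_two] at heq
      push_cast at heq hle
      linarith
    · have hc : net.setCost ((insert e {(2, false), (1, true)} :
          Finset (Fin 8 × Bool)) : Set _) = (210 : ℕ) :=
        setCost_coe_eq (by obtain rfl | rfl | rfl := he <;> decide)
      have hp : net.setPrize ((insert e {(2, false), (1, true)} :
          Finset (Fin 8 × Bool)) : Set _) = (87 : ℕ) :=
        setPrize_coe_eq (by obtain rfl | rfl | rfl := he <;> decide)
      rw [hc, hp, setCost_two, setPrize_two] at heq
      push_cast at heq hle
      linarith

/-- The algorithm starts with the edges of the path through the vertices `1`, `2`, `3`. -/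
theorem exists_eq_of_greedyOutput {π : List (Fin 8 × Bool)} (h : net.GreedyOutput π) :
    ∃ π', π = (1, true) :: (2, false) :: (3, false) :: π' := by
  have htot : net.totalPrize ≠ net.setPrize ∅ := by
    have h1 := regular.setPrize_le_totalPrize (X := (tree : Set (Fin 8 × Bool)))
    have h2 : net.setPrize (tree : Set (Fin 8 × Bool)) = (432 : ℕ) := setPrize_coe_eq (by decide)
    rw [h2] at h1
    rw [setPrize_empty_eq]
    push_cast at h1
    linarith
  obtain ⟨S, lam, ρ, π', rfl, hrel, hne, hρ, hnd, hfeas, hstep⟩ :=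
    h.exists_first_phase regular inst.coverable htot
  obtain rfl := eq_tree_of_relMinMax hrel hne
  have hlen : ρ.length = 7 := by
    have h1 : ρ.toFinset = tree := by
      apply Finset.coe_injective
      rw [List.coe_toFinset, hρ]
    rw [← List.toFinset_card_of_nodup hnd, h1]
    decide
  have hmem : ∀ f ∈ ρ, f ∈ tree := fun f hf => by
    have : f ∈ (tree : Set (Fin 8 × Bool)) := hρ ▸ hf
    exact this
  obtain _ | ⟨a, _ | ⟨b, _ | ⟨c, l⟩⟩⟩ := ρ
  · simp at hlen
  · simp at hlen
  · simp at hlen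
  have hlen' : 3 ≤ (a :: b :: c :: l).length := by simp
  have s1 : {f | f ∈ (a :: b :: c :: l).take 1} =
      (({a} : Finset (Fin 8 × Bool)) : Set (Fin 8 × Bool)) := by
    ext f
    simp
  have s2 : {f | f ∈ (a :: b :: c :: l).take 2} =
      insert b (({a} : Finset (Fin 8 × Bool)) : Set (Fin 8 × Bool)) := by
    ext f
    simp [or_comm]
  have f1 := hfeas 1 (by omega)
  have f2 := hfeas 2 (by omega)
  obtain ⟨S₁, lam₁, h1⟩ := hstep 1 (by omega)
  obtain ⟨S₂, lam₂, h2⟩ := hstep 2 (by omega)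
  rw [s1] at f1 h1
  rw [s2] at f2 h2
  have ha : a = (1, true) := by
    have := one_mem_of_feasible f1 (by
      rw [Finset.coe_singleton]
      exact Set.singleton_subset_iff.2 (hmem a (by simp))) ⟨a, by simp⟩
    rw [Finset.coe_singleton] at this
    exact this.symm
  subst ha
  simp only [List.nodup_cons, List.mem_cons, not_or] at hnd
  have hb : b = (2, false) := second_edge h1 (fun h => hnd.1.1 h.symm) f2
  subst hb
  rw [← Finset.coe_insert] at h2
  have hc : c = (3, false) :=
    third_edge h2 (fun h => hnd.1.2.1 h.symm) fun h => hnd.2.1.1 h.symm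
  subst hc
  exact ⟨l ++ π', by simp⟩

theorem chi_le : net.chi ≤ 91 := by
  have hcost : ∀ e, edgeCost e ≤ 91 := by decide
  refine csSup_le ⟨_, Set.mem_image_of_mem _ (Set.mem_univ (0 : Fin 8))⟩ ?_
  rintro _ ⟨v, -, rfl⟩
  have hbdd : BddBelow {x | ∃ w, IsPath net.graph net.root w v ∧
      x = net.listCost (w.map Prod.fst)} := by
    refine ⟨0, ?_⟩
    rintro _ ⟨w, -, rfl⟩
    refine List.sum_nonneg fun x hx => ?_
    obtain ⟨e, -, rfl⟩ := List.mem_map.1 hx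
    exact Nat.cast_nonneg _
  by_cases hv : v = 0
  · subst hv
    have := csInf_le hbdd ⟨[], ⟨.nil (Set.mem_univ _), by simp⟩, rfl⟩
    refine le_trans this ?_
    simp [listCost]
  · have he : IsEdge (v, true) := ⟨hv, by simp⟩
    have := csInf_le hbdd ⟨[((v, true), v)],
      ⟨.cons (isLink_parent he) (.nil (Set.mem_univ _)), by
        have : net.root ≠ v := fun h => hv h.symm
        simpa using this⟩, rfl⟩
    refine le_trans this ?_
    have h1 : net.listCost (([((v, true), v)] : List ((Fin 8 × Bool) × Fin 8)).map Prod.fst) =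
        (edgeCost (v, true) : ℝ) := by
      simp [listCost, net]
    rw [h1]
    exact_mod_cast hcost _

/-- With `B = 91` the direct edge to `3` earns 87, while the budget `91 + χ ≤ 182` allows at most
the first two edges of the detour, whose prize is 0. -/
theorem not_isCompetitiveOn {A : Algorithm} (hA : IsDensityGreedy A) (μ : ℝ) :
    ¬ IsCompetitiveOn ConnectedSimple A (fun I => I.net.chi) μ := by
  intro hcomp
  obtain ⟨π', hπ⟩ := exists_eq_of_greedyOutput (π := A inst) (hA inst)
  obtain ⟨T, hT⟩ := exists_isOpt (N := net) regular.root_mem (B := 91) (by norm_num)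
  have h1 : net.prizeOf T ≤ μ * net.prizeOf (net.algTree (A inst) (91 + net.chi)) :=
    (hcomp inst inst_mem_connectedSimple).2 91 (by norm_num) T hT
  have hf : net.Feasible (({(3, true)} : Finset (Fin 8 × Bool)) : Set _) :=
    feasible_insert (e := (3, true)) feasible_empty (by decide)
  have hp : net.setPrize (({(3, true)} : Finset (Fin 8 × Bool)) : Set _) = (87 : ℕ) :=
    setPrize_coe_eq (by decide)
  have hc : net.setCost (({(3, true)} : Finset (Fin 8 × Bool)) : Set _) = (91 : ℕ) :=
    setCost_coe_eq (by decide)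
  have h2 : net.setPrize (({(3, true)} : Finset (Fin 8 × Bool)) : Set _) ≤ net.prizeOf T := by
    refine hT.2 _ (hf.isRootedSubtree regular.root_mem) ?_
    rw [costOf_rooted hf.subset, hc]
    norm_num
  have h3 : net.prizeOf (net.algTree (A inst) (91 + net.chi)) = 0 := by
    rw [hπ]
    refine le_antisymm ?_ (regular.setPrize_nonneg (X := {e | ∃ i, _ ∧ _}))
    have hsub : {e | ∃ i, ((1, true) :: (2, false) :: (3, false) :: π')[i]? = some e ∧
        net.listCost (((1, true) :: (2, false) :: (3, false) :: π').take (i + 1)) ≤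
          91 + net.chi} ⊆ (({(2, false), (1, true)} : Finset (Fin 8 × Bool)) : Set _) := by
      rintro e ⟨i, hi, hle⟩
      obtain _ | _ | i := i
      · simp at hi
        simp [← hi]
      · simp at hi
        simp [← hi]
      -- From the third edge on, the prefix costs at least 90 + 51 + 42 = 183.
      · exfalso
        have h4 : 0 ≤ net.listCost (π'.take i) := by
          refine List.sum_nonneg fun x hx => ?_
          obtain ⟨e, -, rfl⟩ := List.mem_map.1 hx
          exact Nat.cast_nonneg _
        have h5 : net.listCost (((1, true) :: (2, false) :: (3, false) :: π').take (i + 1 + 1 + 1)) =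
            (edgeCost (1, true) : ℝ) + (edgeCost (2, false) + (edgeCost (3, false) +
              net.listCost (π'.take i))) := rfl
        rw [h5, show edgeCost (1, true) = 90 from rfl, show edgeCost (2, false) = 51 from rfl,
          show edgeCost (3, false) = 42 from rfl] at hle
        have h6 := chi_le
        push_cast at hle
        linarith
    refine (regular.setPrize_mono hsub).trans ?_
    rw [setPrize_two, Nat.cast_zero]
  rw [h3, mul_zero] at h1
  rw [hp] at h2
  push_cast at h2
  linarith

end Detour

end PCST

end

theorem theorem3 :
    (∃ A : PCST.Algorithm, PCST.IsDensityGreedy A) ∧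
    ∀ A : PCST.Algorithm, PCST.IsDensityGreedy A →
      PCST.IsCompetitiveOn Set.univ A (fun I => I.net.gamma) 2 ∧
      ∀ μ : ℝ, 1 ≤ μ →
        ¬ PCST.IsCompetitiveOn PCST.ConnectedSimple A (fun I => I.net.chi) μ :=
  ⟨PCST.exists_isDensityGreedy, fun _ hA =>
    ⟨hA.isCompetitiveOn, fun μ _ => PCST.Detour.not_isCompetitiveOn hA μ⟩⟩
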